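/- \textbf{Constraint propagation.} Summation convention, Latin indices from $1$ to $3$. Let $C^k_{ij}$ be the structure constants, $[e_i,e_j]=C^k_{ij}e_k$, of a three-dimensional real Lie algebra in a basis $(e_i)$ (in particular, of one of Bianchi type I to VIII), and let $m,\Lambda\in\mathbb{R}$ (with $m>0$ the mass of the scalar field and $\Lambda$ the cosmological constant). Let $I\subseteq\mathbb{R}$ be an interval containing $0$, and let $(g_{ij},k_{ij},E^i,F_{ij},u^i,\Phi,U,\rho,e)$ be real functions on $I$, with $(g_{ij})$ symmetric positive definite, $(k_{ij})$ symmetric, $(F_{ij})$ antisymmetric, $U\ge 0$ and $\rho>0$. Indices are raised and lowered with $g$, and $$H=g^{ij}k_{ij},\quad u^0=\sqrt{1+g_{ij}u^iu^j},\quad u_0=-u^0,$$ $$\gamma^l_{ij}=\tfrac12 g^{lk}\left(-C^n_{jk}g_{in}+C^n_{ki}g_{jn}+C^n_{ij}g_{kn}\right),$$ $$R_{ij}=\gamma^l_{ln}\gamma^n_{ji}-\gamma^n_{jl}\gamma^l_{ni}-C^l_{nj}\gamma^n_{li},\quad R=g^{ij}R_{ij},\quad \nabla_lk_{ij}=-\gamma^n_{li}k_{nj}-\gamma^n_{lj}k_{in},$$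 $$T_{00}=U+\tfrac12m^2\Phi^2,\quad T_{0i}=0,\quad T_{ij}=\tfrac12g_{ij}(2U-m^2\Phi^2),$$ $$\tau_{00}=\tfrac12g_{ij}E^iE^j+\tfrac14g^{ik}g^{jl}F_{ij}F_{kl},\quad \tau_{0j}=-E^kF_{jk},$$ $$\tau_{ij}=\left(\tfrac12g_{ij}g_{kl}-g_{ik}g_{jl}\right)E^kE^l-\tfrac14g_{ij}g^{kp}g^{lq}F_{kl}F_{pq}+g^{kl}F_{ik}F_{jl}.$$ Suppose that these functions are differentiable and satisfy on $I$ the evolution system $$\dot g_{ij}=-2k_{ij},$$ $$\dot k_{ij}=R_{ij}+Hk_{ij}-2k^l_jk_{il}-8\pi(T_{ij}+\tau_{ij}+\rho u_iu_j)+4\pi\left[-T_{00}-\rho u_0^2+g^{ln}(T_{ln}+\rho u_lu_n)\right]g_{ij}-\Lambda g_{ij},$$ $$\dot E^i=HE^i-\left(C^j_{jk}g^{kl}g^{in}+\tfrac12C^i_{jk}g^{jl}g^{kn}\right)F_{ln}+4\pi eu^i,\qquad \dot F_{ij}=C^k_{ij}g_{kl}E^l,$$ $$\dot u^i=2k^i_ju^j-\gamma^i_{jk}\frac{u^ju^k}{u^0}-4\pi\frac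 e\rho E^i+4\pi\frac e\rho\,\frac{g^{il}F_{jl}u^j}{u^0},$$ $$\dot\Phi=\sqrt{2U},\qquad \dot U=2HU-m^2\Phi\sqrt{2U},$$ $$\dot\rho=-\left[k_{ij}\frac{u^iu^j}{(u^0)^2}+C^i_{ij}\frac{u^j}{u^0}-k^i_i\right]\rho+4\pi e\,g_{ij}\frac{E^ju^i}{(u^0)^2},$$ $$\dot e=-\left[k_{ij}\frac{u^iu^j}{(u^0)^2}+C^i_{ij}\frac{u^j}{u^0}-k^i_i\right]e+4\pi g_{ij}\frac{E^ju^i}{(u^0)^2}\,\frac{e^2}{\rho}.$$ Then the constraints $$R-k_{ij}k^{ij}+H^2=16\pi(T_{00}+\tau_{00}+\rho u_0^2)+2\Lambda,$$ $$\nabla^ik_{ij}=-8\pi(T_{0j}+\tau_{0j}+\rho u_0u_j),$$ $$C^l_{ij}F_{kl}+C^l_{ki}F_{jl}+C^l_{jk}F_{il}=0,$$ $$C^i_{ik}E^k+4\pi eu^0=0$$ (for all $i,j,k$) hold at every $t\in I$ if and only if they hold at $t=0$. -/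

import Mathlib

open scoped Matrix

noncomputable section

namespace EMS

/-- Structure constants `C^k_{ij}` of a three-dimensional real Lie algebra in the basis `b`,
that is `[e_i, e_j] = C^k_{ij} e_k`; the arguments are ordered as `structureConst b k i j`. -/
def structureConst {𝔤 : Type*} [LieRing 𝔤] [LieAlgebra ℝ 𝔤] (b : Module.Basis (Fin 3) ℝ 𝔤)
    (k i j : Fin 3) : ℝ :=
  b.repr ⁅b i, b j⁆ k

/-- Values of the unknowns at one time, as components in the left invariant frame:
the metric `g_{ij}`, the second fundamental form `k_{ij}`, the electric part `E^i = F^{0i}` and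
the magnetic part `F_{ij}` of the electromagnetic field, the spatial components `u^i` of the
velocity, the scalar field `Φ`, the quantity `U = (dΦ/dt)^2 / 2`, the proper density `ρ` of
the matter, the proper charge density `e`. -/
structure State where
  g : Matrix (Fin 3) (Fin 3) ℝ
  k : Matrix (Fin 3) (Fin 3) ℝ
  E : Fin 3 → ℝ
  F : Matrix (Fin 3) (Fin 3) ℝ
  u : Fin 3 → ℝ
  Φ : ℝ
  U : ℝ
  ρ : ℝ
  e : ℝ

/-- The set in which the unknowns take their values: `g` is a Riemannian metric, `k` is
symmetric, `F` is a 2-form, `U = (dΦ/dt)^2 / 2` is nonnegative, the density is positive. -/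
structure State.Admissible (s : State) : Prop where
  g_posDef : s.g.PosDef
  k_symm : s.k.IsSymm
  F_antisymm : s.Fᵀ = -s.F
  U_nonneg : 0 ≤ s.U
  rho_pos : 0 < s.ρ

namespace State

variable (C : Fin 3 → Fin 3 → Fin 3 → ℝ) (m Λ : ℝ) (s : State)

/-- The inverse metric `g^{ij}`. -/
def ginv : Matrix (Fin 3) (Fin 3) ℝ := s.g⁻¹

/-- `k^i_j = g^{il} k_{lj}`. -/
def kMixed (i j : Fin 3) : ℝ := ∑ l, s.ginv i l * s.k l j

/-- `k^{ij} = g^{il} g^{jm} k_{lm}`. -/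
def kUp (i j : Fin 3) : ℝ := ∑ l, ∑ n, s.ginv i l * s.ginv j n * s.k l n

/-- The mean curvature `H = g^{ij} k_{ij}`. -/
def H : ℝ := ∑ i, ∑ j, s.ginv i j * s.k i j

/-- `u_i = g_{ij} u^j`. -/
def uLow (i : Fin 3) : ℝ := ∑ j, s.g i j * s.u j

/-- `u^0 = √(1 + g_{ij} u^i u^j)`. -/
def u0 : ℝ := √(1 + ∑ i, ∑ j, s.g i j * s.u i * s.u j)

/-- `u_0 = -u^0`, as the metric of the space-time is `-dt² + g`. -/
def u0Low : ℝ := -s.u0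

/-- The rotation coefficients `γ^l_{ij}` of the Levi-Civita connection of the left invariant
metric `g`, that is `∇_{e_i} e_j = γ^l_{ij} e_l`. -/
def gam (l i j : Fin 3) : ℝ :=
  (1 / 2) * ∑ n, s.ginv l n *
    ((-∑ p, C p j n * s.g i p) + (∑ p, C p n i * s.g j p) + ∑ p, C p i j * s.g n p)

/-- The Ricci tensor `R_{ij}` of `g`. -/
def ric (i j : Fin 3) : ℝ :=
  (∑ l, ∑ n, s.gam C l l n * s.gam C n j i)
    - (∑ l, ∑ n, s.gam C n j l * s.gam C l n i)
    - ∑ l, ∑ n, C l n j * s.gam C n l i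

/-- The scalar curvature `R = g^{ij} R_{ij}` of `g`. -/
def scal : ℝ := ∑ i, ∑ j, s.ginv i j * s.ric C i j

/-- The covariant derivative `∇_l k_{ij}`; the components `k_{ij}` are constant on `G`. -/
def covK (l i j : Fin 3) : ℝ :=
  -(∑ n, s.gam C n l i * s.k n j) - ∑ n, s.gam C n l j * s.k i n

/-- The divergence `∇^i k_{ij} = g^{il} ∇_l k_{ij}`. -/
def divK (j : Fin 3) : ℝ := ∑ i, ∑ l, s.ginv i l * s.covK C l i j

/-- The time derivative `dΦ/dt = √(2U)` of the scalar field. -/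
def dotPhi : ℝ := √(2 * s.U)

/-- `T_{00}`, where `T` is the stress-energy tensor of the scalar field of mass `m`. -/
def T00 : ℝ := (1 / 2) * s.dotPhi ^ 2 + (1 / 2) * m ^ 2 * s.Φ ^ 2

/-- `T_{0i}`, which vanishes as `Φ` depends only on `t`. -/
def T0 (_s : State) (_i : Fin 3) : ℝ := 0

/-- `T_{ij}`. -/
def T (i j : Fin 3) : ℝ := (1 / 2) * s.g i j * (s.dotPhi ^ 2 - m ^ 2 * s.Φ ^ 2)

/-- `g_{ij} E^i E^j`. -/
def normE : ℝ := ∑ i, ∑ j, s.g i j * s.E i * s.E j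

/-- `g^{ik} g^{jl} F_{ij} F_{kl}`. -/
def normF : ℝ := ∑ i, ∑ j, ∑ k, ∑ l, s.ginv i k * s.ginv j l * s.F i j * s.F k l

/-- `τ_{00}`, where `τ` is the stress-energy tensor of the electromagnetic field. -/
def tau00 : ℝ := (1 / 2) * s.normE + (1 / 4) * s.normF

/-- `τ_{0j}`. -/
def tau0 (j : Fin 3) : ℝ := -∑ k, s.E k * s.F j k

/-- `τ_{ij}`. -/
def tau (i j : Fin 3) : ℝ :=
  (∑ k, ∑ l, ((1 / 2) * s.g i j * s.g k l - s.g i k * s.g j l) * s.E k * s.E l)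
    - (1 / 4) * s.g i j * s.normF
    + ∑ k, ∑ l, s.ginv k l * s.F i k * s.F j l

/-! Right-hand sides of the evolution system. -/

/-- `dg_{ij}/dt`. -/
def rhsG (i j : Fin 3) : ℝ := -2 * s.k i j

/-- `dk_{ij}/dt`. -/
def rhsK (i j : Fin 3) : ℝ :=
  s.ric C i j + s.H * s.k i j - 2 * (∑ l, s.kMixed l j * s.k i l)
    - 8 * Real.pi * (s.T m i j + s.tau i j + s.ρ * s.uLow i * s.uLow j)
    + 4 * Real.pi *
        (-s.T00 m - s.ρ * s.u0Low ^ 2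
          + ∑ l, ∑ n, s.ginv l n * (s.T m l n + s.ρ * s.uLow l * s.uLow n)) * s.g i j
    - Λ * s.g i j

/-- `dE^i/dt`. -/
def rhsE (i : Fin 3) : ℝ :=
  s.H * s.E i
    - (∑ j, ∑ k, ∑ l, ∑ n,
        (C j j k * s.ginv k l * s.ginv i n * s.F l n
          + (1 / 2) * C i j k * s.ginv j l * s.ginv k n * s.F l n))
    + 4 * Real.pi * s.e * s.u i

/-- `dF_{ij}/dt`. -/
def rhsF (i j : Fin 3) : ℝ := ∑ k, ∑ l, C k i j * s.g k l * s.E l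

/-- `du^i/dt`. -/
def rhsU (i : Fin 3) : ℝ :=
  2 * (∑ j, s.kMixed i j * s.u j)
    - (∑ j, ∑ k, s.gam C i j k * s.u j * s.u k / s.u0)
    - 4 * Real.pi * (s.e / s.ρ) * s.E i
    + 4 * Real.pi * (s.e / s.ρ) * ((∑ l, ∑ j, s.ginv i l * s.F j l * s.u j) / s.u0)

/-- `k_{ij} u^i u^j / (u^0)² + C^i_{ij} u^j / u^0 - k^i_i`. -/
def expansion : ℝ :=
  (∑ i, ∑ j, s.k i j * s.u i * s.u j / s.u0 ^ 2)
    + (∑ i, ∑ j, C i i j * s.u j / s.u0) - ∑ i, s.kMixed i i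

/-- `g_{ij} E^j u^i / (u^0)²`. -/
def work : ℝ := ∑ i, ∑ j, s.g i j * s.E j * s.u i / s.u0 ^ 2

/-- The constraint equations: the Hamiltonian constraint, the momentum constraints and the two
Maxwell constraints. -/
structure Constraints : Prop where
  hamiltonian :
    s.scal C - (∑ i, ∑ j, s.k i j * s.kUp i j) + s.H ^ 2
      = 16 * Real.pi * (s.T00 m + s.tau00 + s.ρ * s.u0Low ^ 2) + 2 * Λ
  momentum : ∀ j,
    s.divK C j = -8 * Real.pi * (s.T0 j + s.tau0 j + s.ρ * s.u0Low * s.uLow j)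
  magnetic : ∀ i j k,
    (∑ l, C l i j * s.F k l) + (∑ l, C l k i * s.F j l) + (∑ l, C l j k * s.F i l) = 0
  electric :
    (∑ i, ∑ k, C i i k * s.E k) + 4 * Real.pi * s.e * s.u0 = 0

end State

/-- The curve `s` solves the evolution system on the set `I` of times, one-sidedly at the
endpoints of `I` that belong to `I`. -/
structure IsSolutionOn (C : Fin 3 → Fin 3 → Fin 3 → ℝ) (m Λ : ℝ) (s : ℝ → State)
    (I : Set ℝ) : Prop where
  admissible : ∀ t ∈ I, (s t).Admissible
  eq_g : ∀ t ∈ I, ∀ i j, HasDerivWithinAt (fun r => (s r).g i j) ((s t).rhsG i j) I t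
  eq_k : ∀ t ∈ I, ∀ i j, HasDerivWithinAt (fun r => (s r).k i j) ((s t).rhsK C m Λ i j) I t
  eq_E : ∀ t ∈ I, ∀ i, HasDerivWithinAt (fun r => (s r).E i) ((s t).rhsE C i) I t
  eq_F : ∀ t ∈ I, ∀ i j, HasDerivWithinAt (fun r => (s r).F i j) ((s t).rhsF C i j) I t
  eq_u : ∀ t ∈ I, ∀ i, HasDerivWithinAt (fun r => (s r).u i) ((s t).rhsU C i) I t
  eq_Phi : ∀ t ∈ I, HasDerivWithinAt (fun r => (s r).Φ) (√(2 * (s t).U)) I t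
  eq_U : ∀ t ∈ I, HasDerivWithinAt (fun r => (s r).U)
    (2 * (s t).H * (s t).U - m ^ 2 * (s t).Φ * √(2 * (s t).U)) I t
  eq_rho : ∀ t ∈ I, HasDerivWithinAt (fun r => (s r).ρ)
    (-(s t).expansion C * (s t).ρ + 4 * Real.pi * (s t).e * (s t).work) I t
  eq_e : ∀ t ∈ I, HasDerivWithinAt (fun r => (s r).e)
    (-(s t).expansion C * (s t).e
      + 4 * Real.pi * (s t).work * ((s t).e ^ 2 / (s t).ρ)) I t

end EMS

end

noncomputable section

namespace EMS

/-! The defect of a constraint is the difference of its two sides. Along the evolution the defects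
solve linear homogeneous equations that can be treated one after the other. The magnetic defect is
constant in time, by the Jacobi identity (`hasDerivWithinAt_magnetic`). The electric defect `A`
satisfies `A' = H A`. Where both vanish, the momentum defect satisfies `M_j' = H M_j`. In an
orthonormal frame the Hamiltonian defect satisfies `D' = 2 H D - 2 C^i_{ij} M_j`, so `D' = 2 H D`
where `M` vanishes. Since `H` is continuous, a Grönwall argument in both time directions
(`eq_zero_of_hasDerivWithinAt_mul_self`) shows that a defect that vanishes at one time vanishes
throughout.

The rates of the last three defects are computed separately at each time `t`. A basis of the Lie
algebra that is orthonormal for `g(t)` is chosen and kept constant in time. All unknowns, right-hand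
sides and defects are tensorial under a constant change of basis (the `pull` lemmas), so it suffices
to work in this basis at the single instant `t`, where `g = 1` and `g^{ij}` has derivative `2
k_{ij}`.

What remains is polynomial algebra in components: the variation of the connection and of the scalar
curvature (`dconn_eq`, `trace_dric`), the contracted Bianchi identity (`odiv_oric`), the divergence
of the Maxwell stresses (`odiv_maxwell`), and the conservation of mass and charge, where the work
done by the electric field cancels between `ρ` or `e` and `u^0`. -/

/-- A tensor with one upper and two lower indices. -/
abbrev Tensor12 := Fin 3 → Fin 3 → Fin 3 → ℝ

/-- Square matrices indexed by the vectors of a frame. -/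
abbrev Mat3 := Matrix (Fin 3) (Fin 3) ℝ

/-! ### Tensor operations and their covariance under a change of frame. -/

namespace Tensor12

/-- The endomorphism `X^l_{ij}` with the first lower index fixed. -/
def slice (X : Tensor12) (i : Fin 3) : Mat3 := Matrix.of fun l j => X l i j

/-- Exchange of the two lower indices. -/
def swap (X : Tensor12) : Tensor12 := fun l i j => X l j i

/-- Components of a tensor in the frame `P`, with inverse `Q`. -/
def pull (P Q : Mat3) (X : Tensor12) : Tensor12 :=
  fun l i j => ∑ b, P b i * (Q * X.slice b * P) l j

/-- The adjoint of each slice with respect to `g`, with inverse `h`. -/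
def adj (h g : Mat3) (X : Tensor12) : Tensor12 :=
  fun l i j => (h * (X.slice i)ᵀ * gᵀ) l j

/-- Composition of each slice with `M`. -/
def lmul (M : Mat3) (X : Tensor12) : Tensor12 := fun l i j => (M * X.slice i) l j

/-- `tr (M X_j)`. -/
def mixVec (M : Mat3) (X : Tensor12) : Fin 3 → ℝ := fun j => (M * X.slice j).trace

/-- `M^{ij} X^n_{ij}`. -/
def conVec (M : Mat3) (X : Tensor12) : Fin 3 → ℝ := fun n => (M * (Matrix.of (X n))ᵀ).trace

/-- `w_n X^n_{ij}`. -/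
def lowMat (w : Fin 3 → ℝ) (X : Tensor12) : Mat3 := Matrix.of fun i j => ∑ n, w n * X n i j

/-- `tr (X_i Y_j)`. -/
def trForm (X Y : Tensor12) : Mat3 := Matrix.of fun i j => (X.slice i * Y.slice j).trace

theorem mixVec_one (X : Tensor12) (j : Fin 3) : X.mixVec 1 j = ∑ l, X l j l := by
  simp [mixVec, slice, Matrix.trace]

theorem conVec_apply (M : Mat3) (X : Tensor12) (n : Fin 3) :
    X.conVec M n = ∑ i, ∑ j, M i j * X n i j := by
  simp [conVec, Matrix.trace, Matrix.mul_apply]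

variable {P Q : Mat3}

theorem slice_pull (X : Tensor12) (i : Fin 3) :
    (X.pull P Q).slice i = ∑ b, P b i • (Q * X.slice b * P) := by
  ext l j
  simp [slice, pull, Matrix.sum_apply]

theorem swap_pull (X : Tensor12) : (X.pull P Q).swap = X.swap.pull P Q := by
  funext l i j
  simp only [pull, swap, slice, Matrix.mul_apply, Matrix.of_apply, Fin.sum_univ_three]
  ring

theorem pull_add (X Y : Tensor12) : (X + Y).pull P Q = X.pull P Q + Y.pull P Q := by
  funext l i j
  simp only [pull, slice, Matrix.mul_apply, Matrix.of_apply, Fin.sum_univ_three, Pi.add_apply]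
  ring

theorem pull_smul (a : ℝ) (X : Tensor12) : (a • X).pull P Q = a • X.pull P Q := by
  funext l i j
  simp only [pull, slice, Matrix.mul_apply, Matrix.of_apply, Fin.sum_univ_three, Pi.smul_apply,
    smul_eq_mul]
  ring

theorem cancel_PQ (hPQ : P * Q = 1) (A B : Mat3) : A * P * (Q * B) = A * B := by
  rw [Matrix.mul_assoc, ← Matrix.mul_assoc P, hPQ, Matrix.one_mul]

/-- The metric pulls back to `Pᵀ g P` and its inverse to `Q h Qᵀ`, so the inner factors `P` and `Q`
cancel and the adjoint for the new metric is the transformed adjoint. -/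
theorem adj_pull (hPQ : P * Q = 1) (h g : Mat3) (X : Tensor12) :
    (X.pull P Q).adj (Q * h * Qᵀ) (Pᵀ * g * P) = (X.adj h g).pull P Q := by
  have hQPt : Qᵀ * Pᵀ = 1 := by rw [← Matrix.transpose_mul, hPQ, Matrix.transpose_one]
  have key (b : Fin 3) : Q * h * Qᵀ * (Q * X.slice b * P)ᵀ * (Pᵀ * g * P)ᵀ
      = Q * (h * (X.slice b)ᵀ * gᵀ) * P := by
    simp only [Matrix.transpose_mul, Matrix.transpose_transpose, Matrix.mul_assoc]
    rw [← Matrix.mul_assoc Qᵀ Pᵀ, hQPt, Matrix.one_mul, ← Matrix.mul_assoc Qᵀ Pᵀ, hQPt,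
      Matrix.one_mul]
  funext l i j
  rw [adj, slice_pull, Matrix.transpose_sum, Matrix.mul_sum, Matrix.sum_mul, Matrix.sum_apply]
  refine Finset.sum_congr rfl fun b _ => ?_
  rw [Matrix.transpose_smul, Matrix.mul_smul, Matrix.smul_mul, key, Matrix.smul_apply, smul_eq_mul]
  rfl

theorem lmul_pull (hPQ : P * Q = 1) (M : Mat3) (X : Tensor12) :
    (X.pull P Q).lmul (Q * M * P) = (X.lmul M).pull P Q := by
  funext l i j
  rw [lmul, slice_pull, Matrix.mul_sum, Matrix.sum_apply]
  refine Finset.sum_congr rfl fun b _ => ?_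
  rw [Matrix.mul_smul, Matrix.smul_apply, smul_eq_mul]
  have : Q * M * P * (Q * X.slice b * P) = Q * (M * X.slice b) * P := by
    rw [Matrix.mul_assoc Q (slice X b), cancel_PQ hPQ]
    simp only [Matrix.mul_assoc]
  rw [this]
  rfl

theorem trace_conj (hPQ : P * Q = 1) (A : Mat3) : (Q * A * P).trace = A.trace := by
  rw [Matrix.trace_mul_comm, ← Matrix.mul_assoc, hPQ, Matrix.one_mul]

theorem mul_conj (hPQ : P * Q = 1) (A B : Mat3) :
    Q * A * P * (Q * B * P) = Q * (A * B) * P := by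
  rw [Matrix.mul_assoc Q B, cancel_PQ hPQ]
  simp only [Matrix.mul_assoc]

theorem mixVec_pull (hPQ : P * Q = 1) (M : Mat3) (X : Tensor12) :
    (X.pull P Q).mixVec (Q * M * P) = Pᵀ *ᵥ X.mixVec M := by
  funext j
  simp only [mixVec, slice_pull, Matrix.mul_sum, Matrix.mul_smul, mul_conj hPQ, Matrix.trace_sum,
    Matrix.trace_smul, trace_conj hPQ, Matrix.mulVec, dotProduct, Matrix.transpose_apply,
    smul_eq_mul]

theorem trForm_pull (hPQ : P * Q = 1) (X Y : Tensor12) :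
    (X.pull P Q).trForm (Y.pull P Q) = Pᵀ * X.trForm Y * P := by
  ext i j
  simp only [trForm, slice_pull, Matrix.mul_sum, Matrix.mul_smul, Matrix.smul_mul,
    mul_conj hPQ, Matrix.trace_sum, Matrix.trace_smul, trace_conj hPQ, Matrix.of_apply,
    Matrix.mul_apply, Matrix.transpose_apply, smul_eq_mul, Finset.sum_mul]
  rw [Finset.sum_comm]
  refine Finset.sum_congr rfl fun b _ => Finset.sum_congr rfl fun a _ => ?_
  ring

theorem lowMat_eq (w : Fin 3 → ℝ) (X : Tensor12) (i j : Fin 3) :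
    X.lowMat w i j = (w ᵥ* X.slice i) j := rfl

theorem lowMat_pull (hPQ : P * Q = 1) (w : Fin 3 → ℝ) (X : Tensor12) :
    (X.pull P Q).lowMat (Pᵀ *ᵥ w) = Pᵀ * X.lowMat w * P := by
  have key (b : Fin 3) : (Pᵀ *ᵥ w) ᵥ* (Q * X.slice b * P) = w ᵥ* X.slice b ᵥ* P := by
    rw [Matrix.mulVec_transpose, Matrix.vecMul_vecMul, Matrix.mul_assoc Q, ← Matrix.mul_assoc P,
      hPQ, Matrix.one_mul, Matrix.vecMul_vecMul]
  ext i j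
  rw [lowMat_eq, slice_pull, Matrix.vecMul_sum, Finset.sum_apply, Matrix.mul_assoc,
    Matrix.mul_apply]
  refine Finset.sum_congr rfl fun b _ => ?_
  rw [Matrix.vecMul_smul, key]
  rfl

theorem of_pull (X : Tensor12) (n : Fin 3) :
    Matrix.of (X.pull P Q n) = ∑ a, Q n a • (Pᵀ * Matrix.of (X a) * P) := by
  ext i j
  simp only [pull, slice, Matrix.mul_apply, Matrix.of_apply, Fin.sum_univ_three, Matrix.add_apply,
    Matrix.smul_apply, Matrix.transpose_apply, smul_eq_mul]
  ring

theorem conVec_pull (hPQ : P * Q = 1) (M : Mat3) (X : Tensor12) :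
    (X.pull P Q).conVec (Q * M * Qᵀ) = Q *ᵥ X.conVec M := by
  have hQPt : Qᵀ * Pᵀ = 1 := by rw [← Matrix.transpose_mul, hPQ, Matrix.transpose_one]
  funext n
  simp only [conVec, of_pull, Matrix.transpose_sum, Matrix.transpose_smul, Matrix.mul_sum,
    Matrix.mul_smul, Matrix.trace_sum, Matrix.trace_smul, Matrix.mulVec, dotProduct, smul_eq_mul]
  refine Finset.sum_congr rfl fun a _ => ?_
  congr 1
  rw [Matrix.transpose_mul, Matrix.transpose_mul, Matrix.transpose_transpose,
    Matrix.mul_assoc (Q * M), ← Matrix.mul_assoc Qᵀ, hQPt, Matrix.one_mul,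
    ← trace_conj hPQ (M * (Matrix.of (X a))ᵀ)]
  simp only [Matrix.mul_assoc]

end Tensor12

open Tensor12

namespace State

variable (C : Fin 3 → Fin 3 → Fin 3 → ℝ) (m Λ : ℝ) (s : State)

/-! The tensors of `State` in matrix notation. -/

theorem H_eq : s.H = (s.ginv * s.kᵀ).trace := by
  simp [H, Matrix.trace, Matrix.mul_apply]

theorem kMixed_eq : s.kMixed = s.ginv * s.k := by
  ext i j
  simp [kMixed, Matrix.mul_apply]

theorem kUp_eq : s.kUp = s.ginv * s.k * s.ginvᵀ := by
  ext i j
  simp only [kUp, Matrix.mul_apply, Fin.sum_univ_three, Matrix.transpose_apply]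
  ring

theorem uLow_eq : s.uLow = s.g *ᵥ s.u := rfl

theorem u0_eq : s.u0 = √(1 + s.u ⬝ᵥ (s.g *ᵥ s.u)) := by
  simp only [u0, dotProduct, Matrix.mulVec, Fin.sum_univ_three]
  congr 1
  ring

/-- The three terms of the Koszul formula become adjoints of `ad` and `ad` itself, all built from
operations already known to be covariant. -/
theorem gam_eq : s.gam C = (1 / 2 : ℝ) •
    ((-1 : ℝ) • swap (adj s.ginv s.g C) + adj s.ginv s.g (swap C) + lmul (s.ginv * s.g) C) := by
  funext l i j
  simp only [gam, adj, swap, lmul, slice, Pi.add_apply, Pi.smul_apply, smul_eq_mul,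
    Matrix.mul_apply, Matrix.of_apply, Matrix.transpose_apply, Fin.sum_univ_three]
  ring

theorem ric_eq : Matrix.of (s.ric C) = (lowMat (mixVec 1 (swap (s.gam C))) (s.gam C))ᵀ
    - (trForm (s.gam C) (swap (s.gam C)))ᵀ - (trForm (swap C) (swap (s.gam C)))ᵀ := by
  ext i j
  simp only [ric, lowMat, mixVec_one, trForm, swap, slice, Matrix.of_apply, Matrix.sub_apply,
    Matrix.transpose_apply, Matrix.trace, Matrix.diag, Matrix.mul_apply,
    Fin.sum_univ_three]
  ring

theorem scal_eq : s.scal C = (s.ginv * (Matrix.of (s.ric C))ᵀ).trace := by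
  simp [scal, Matrix.trace, Matrix.mul_apply]

theorem divK_eq : s.divK C = -(s.kᵀ *ᵥ conVec s.ginvᵀ (s.gam C))
    - mixVec (s.ginvᵀ * s.k) (swap (s.gam C)) := by
  funext j
  simp only [divK, covK, conVec, mixVec, swap, slice, Matrix.mulVec, dotProduct, Pi.sub_apply,
    Pi.neg_apply, Matrix.of_apply, Matrix.transpose_apply, Matrix.trace, Matrix.diag,
    Matrix.mul_apply, Fin.sum_univ_three]
  ring

theorem T_eq : Matrix.of (s.T m) = ((1 / 2) * (s.dotPhi ^ 2 - m ^ 2 * s.Φ ^ 2)) • s.g := by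
  ext i j
  simp only [T, Matrix.of_apply, Matrix.smul_apply, smul_eq_mul]
  ring

theorem normE_eq : s.normE = s.E ⬝ᵥ (s.g *ᵥ s.E) := by
  simp only [normE, dotProduct, Matrix.mulVec, Fin.sum_univ_three]
  ring

theorem normF_eq : s.normF = (s.ginvᵀ * s.F * s.ginv * s.Fᵀ).trace := by
  simp only [normF, Matrix.trace, Matrix.diag, Matrix.mul_apply, Matrix.transpose_apply,
    Fin.sum_univ_three]
  ring

theorem tau0_eq : s.tau0 = -(s.F *ᵥ s.E) := by
  funext j
  simp only [tau0, Matrix.mulVec, dotProduct, Pi.neg_apply, mul_comm]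

theorem tau_eq : Matrix.of s.tau = ((1 / 2) * s.normE - (1 / 4) * s.normF) • s.g
    - Matrix.vecMulVec (s.g *ᵥ s.E) (s.g *ᵥ s.E) + s.F * s.ginv * s.Fᵀ := by
  ext i j
  simp only [tau, normE, Matrix.of_apply, Matrix.smul_apply, smul_eq_mul, Matrix.add_apply,
    Matrix.sub_apply, Matrix.vecMulVec_apply, Matrix.mulVec, dotProduct, Matrix.mul_apply,
    Matrix.transpose_apply, Fin.sum_univ_three]
  ring

theorem rhsG_eq : Matrix.of s.rhsG = (-2 : ℝ) • s.k := by
  ext i j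
  simp [rhsG]

/-- The trace of the stresses of the scalar field and of the matter. -/
theorem trace_stress_eq :
    (∑ l, ∑ n, s.ginv l n * (s.T m l n + s.ρ * s.uLow l * s.uLow n))
      = (s.ginv * (Matrix.of (s.T m))ᵀ).trace
        + s.ρ * ((s.g *ᵥ s.u) ⬝ᵥ (s.ginv *ᵥ (s.g *ᵥ s.u))) := by
  simp only [uLow_eq, Matrix.trace, Matrix.diag, Matrix.mul_apply, Matrix.transpose_apply,
    Matrix.of_apply, Fin.sum_univ_three, dotProduct]
  simp only [Matrix.mulVec, dotProduct, Fin.sum_univ_three]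
  ring

theorem rhsK_eq : Matrix.of (s.rhsK C m Λ) = Matrix.of (s.ric C) + s.H • s.k
    - (2 : ℝ) • (s.k * (s.ginv * s.k))
    - (8 * Real.pi) • (Matrix.of (s.T m) + Matrix.of s.tau
      + s.ρ • Matrix.vecMulVec (s.g *ᵥ s.u) (s.g *ᵥ s.u))
    + (4 * Real.pi * (-s.T00 m - s.ρ * s.u0Low ^ 2
      + ((s.ginv * (Matrix.of (s.T m))ᵀ).trace
        + s.ρ * ((s.g *ᵥ s.u) ⬝ᵥ (s.ginv *ᵥ (s.g *ᵥ s.u)))))) • s.g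
    - Λ • s.g := by
  ext i j
  have : ∑ l, s.kMixed l j * s.k i l = (s.k * (s.ginv * s.k)) i j := by
    rw [kMixed_eq, Matrix.mul_apply]
    exact Finset.sum_congr rfl fun l _ => mul_comm _ _
  rw [Matrix.of_apply, rhsK, trace_stress_eq, this]
  simp only [uLow_eq, Matrix.of_apply, Matrix.add_apply,
    Matrix.sub_apply, Matrix.smul_apply, smul_eq_mul, Matrix.vecMulVec_apply]
  ring

theorem rhsE_eq : s.rhsE C = s.H • s.E
    - s.ginv *ᵥ (s.Fᵀ *ᵥ (s.ginvᵀ *ᵥ mixVec 1 (swap C)))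
    - (1 / 2 : ℝ) • conVec (s.ginv * s.F * s.ginvᵀ) C + (4 * Real.pi * s.e) • s.u := by
  have hA (i : Fin 3) : ∑ j, ∑ k, ∑ l, ∑ n, C j j k * s.ginv k l * s.ginv i n * s.F l n
      = (s.ginv *ᵥ (s.Fᵀ *ᵥ (s.ginvᵀ *ᵥ mixVec 1 (swap C)))) i := by
    simp only [Matrix.mulVec, dotProduct, mixVec_one, swap, Matrix.transpose_apply,
      Fin.sum_univ_three]
    ring
  have hB (i : Fin 3) : ∑ j, ∑ k, ∑ l, ∑ n, (1 / 2) * C i j k * s.ginv j l * s.ginv k n * s.F l n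
      = (1 / 2) * conVec (s.ginv * s.F * s.ginvᵀ) C i := by
    simp only [conVec_apply, Matrix.mul_apply, Matrix.transpose_apply, Fin.sum_univ_three]
    ring
  funext i
  simp only [rhsE, Finset.sum_add_distrib, hA, hB, Pi.sub_apply, Pi.add_apply, Pi.smul_apply,
    smul_eq_mul]
  ring

theorem rhsF_eq : Matrix.of (s.rhsF C) = lowMat (s.g *ᵥ s.E) C := by
  ext i j
  simp only [rhsF, lowMat, Matrix.mulVec, dotProduct, Matrix.of_apply, Fin.sum_univ_three]
  ring

theorem rhsU_eq : s.rhsU C = (2 : ℝ) • (s.ginv *ᵥ (s.k *ᵥ s.u))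
    - (1 / s.u0) • conVec (Matrix.vecMulVec s.u s.u) (s.gam C)
    - (4 * Real.pi * (s.e / s.ρ)) • s.E
    + (4 * Real.pi * (s.e / s.ρ) / s.u0) • (s.ginv *ᵥ (s.Fᵀ *ᵥ s.u)) := by
  funext i
  simp only [rhsU, kMixed, conVec, Matrix.mulVec, dotProduct, Pi.sub_apply,
    Pi.add_apply, Pi.smul_apply, smul_eq_mul, Matrix.of_apply, Matrix.transpose_apply,
    Matrix.trace, Matrix.diag, Matrix.vecMulVec_apply, Matrix.mul_apply, Fin.sum_univ_three]
  ring

theorem expansion_eq : s.expansion C = (s.u ⬝ᵥ (s.k *ᵥ s.u)) / s.u0 ^ 2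
    + (mixVec 1 (swap C) ⬝ᵥ s.u) / s.u0 - (s.ginv * s.k).trace := by
  simp only [expansion, kMixed, mixVec_one, swap, Matrix.mulVec, dotProduct,
    Matrix.trace, Matrix.diag, Matrix.mul_apply,
    Fin.sum_univ_three]
  ring

theorem work_eq : s.work = (s.u ⬝ᵥ (s.g *ᵥ s.E)) / s.u0 ^ 2 := by
  simp only [work, Matrix.mulVec, dotProduct, Fin.sum_univ_three]
  ring

end State

/-! ### Covariance of the evolution system under a constant change of frame. -/

namespace State

/-- The components of a state in the frame `P`, with inverse `Q`. -/
def pull (P Q : Mat3) (s : State) : State where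
  g := Pᵀ * s.g * P
  k := Pᵀ * s.k * P
  E := Q *ᵥ s.E
  F := Pᵀ * s.F * P
  u := Q *ᵥ s.u
  Φ := s.Φ
  U := s.U
  ρ := s.ρ
  e := s.e

variable (C : Fin 3 → Fin 3 → Fin 3 → ℝ) (m Λ : ℝ) (s : State) {P Q : Mat3}

theorem pull_g : (s.pull P Q).g = Pᵀ * s.g * P := rfl
theorem pull_k : (s.pull P Q).k = Pᵀ * s.k * P := rfl
theorem pull_E : (s.pull P Q).E = Q *ᵥ s.E := rfl
theorem pull_F : (s.pull P Q).F = Pᵀ * s.F * P := rfl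
theorem pull_u : (s.pull P Q).u = Q *ᵥ s.u := rfl
theorem pull_Φ : (s.pull P Q).Φ = s.Φ := rfl
theorem pull_ρ : (s.pull P Q).ρ = s.ρ := rfl
theorem pull_e : (s.pull P Q).e = s.e := rfl

theorem transpose_cancel (hPQ : P * Q = 1) : Qᵀ * Pᵀ = 1 := by
  rw [← Matrix.transpose_mul, hPQ, Matrix.transpose_one]

theorem cancel_mulVec {A B : Mat3} (h : A * B = 1) (M : Mat3) (x : Fin 3 → ℝ) :
    (M * A) *ᵥ (B *ᵥ x) = M *ᵥ x := by
  rw [Matrix.mulVec_mulVec, Matrix.mul_assoc, h, Matrix.mul_one]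

theorem mulVec_dotProduct_cancel {A B : Mat3} (h : A * B = 1) (x y : Fin 3 → ℝ) :
    (B *ᵥ x) ⬝ᵥ (Aᵀ *ᵥ y) = x ⬝ᵥ y := by
  rw [Matrix.mulVec_transpose, dotProduct_comm, ← Matrix.dotProduct_mulVec, Matrix.mulVec_mulVec,
    h, Matrix.one_mulVec, dotProduct_comm]

theorem vecMulVec_conj (A : Mat3) (x y : Fin 3 → ℝ) :
    Matrix.vecMulVec (A *ᵥ x) (A *ᵥ y) = A * Matrix.vecMulVec x y * Aᵀ := by
  rw [Matrix.mul_vecMulVec, Matrix.vecMulVec_mul, Matrix.vecMul_transpose]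

theorem ginv_pull (hPQ : P * Q = 1) : (s.pull P Q).ginv = Q * s.ginv * Qᵀ := by
  have h1 : P⁻¹ = Q := Matrix.inv_eq_right_inv hPQ
  have h2 : Pᵀ⁻¹ = Qᵀ := Matrix.inv_eq_left_inv (transpose_cancel hPQ)
  rw [ginv, pull_g, Matrix.mul_inv_rev, Matrix.mul_inv_rev, h1, h2, ginv, Matrix.mul_assoc]

theorem conj_mul_low (hPQ : P * Q = 1) (A B : Mat3) :
    Q * A * Qᵀ * (Pᵀ * B * P) = Q * (A * B) * P := by
  have h := transpose_cancel hPQ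
  simp only [Matrix.mul_assoc]
  rw [← Matrix.mul_assoc Qᵀ, h, Matrix.one_mul]

theorem low_mul_conj (hPQ : P * Q = 1) (A B : Mat3) :
    Pᵀ * A * P * (Q * B * P) = Pᵀ * (A * B) * P := by
  simp only [Matrix.mul_assoc]
  rw [← Matrix.mul_assoc P, hPQ, Matrix.one_mul]

theorem conj_mul_up (hPQ : P * Q = 1) (A B : Mat3) :
    Q * A * P * (Q * B * Qᵀ) = Q * (A * B) * Qᵀ := by
  simp only [Matrix.mul_assoc]
  rw [← Matrix.mul_assoc P, hPQ, Matrix.one_mul]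

theorem transpose_low (A : Mat3) : (Pᵀ * A * P)ᵀ = Pᵀ * Aᵀ * P := by
  simp [Matrix.mul_assoc]

theorem transpose_up (A : Mat3) : (Q * A * Qᵀ)ᵀ = Q * Aᵀ * Qᵀ := by
  simp [Matrix.mul_assoc]

theorem low_mulVec (hPQ : P * Q = 1) (A : Mat3) (x : Fin 3 → ℝ) :
    (Pᵀ * A * P) *ᵥ (Q *ᵥ x) = Pᵀ *ᵥ (A *ᵥ x) := by
  rw [cancel_mulVec hPQ, Matrix.mulVec_mulVec]

theorem up_mulVec (hPQ : P * Q = 1) (A : Mat3) (x : Fin 3 → ℝ) :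
    (Q * A * Qᵀ) *ᵥ (Pᵀ *ᵥ x) = Q *ᵥ (A *ᵥ x) := by
  rw [cancel_mulVec (transpose_cancel hPQ), Matrix.mulVec_mulVec]

theorem mixVec_one_pull (hPQ : P * Q = 1) (hQP : Q * P = 1) (X : Tensor12) :
    mixVec 1 (Tensor12.pull P Q X) = Pᵀ *ᵥ mixVec 1 X := by
  rw [← mixVec_pull hPQ, Matrix.mul_one, hQP]

theorem H_pull (hPQ : P * Q = 1) : (s.pull P Q).H = s.H := by
  rw [H_eq, H_eq, ginv_pull s hPQ, pull_k, transpose_low, conj_mul_low hPQ, trace_conj hPQ]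

theorem gam_pull (hPQ : P * Q = 1) :
    (s.pull P Q).gam (Tensor12.pull P Q C) = Tensor12.pull P Q (s.gam C) := by
  rw [gam_eq, gam_eq, ginv_pull s hPQ, pull_g, swap_pull, adj_pull hPQ, adj_pull hPQ,
    conj_mul_low hPQ, lmul_pull hPQ, swap_pull, pull_smul, pull_add, pull_add, pull_smul]

theorem ric_pull (hPQ : P * Q = 1) (hQP : Q * P = 1) :
    Matrix.of ((s.pull P Q).ric (Tensor12.pull P Q C))
    = Pᵀ * Matrix.of (s.ric C) * P := by
  rw [ric_eq, ric_eq, gam_pull C s hPQ, swap_pull, swap_pull, mixVec_one_pull hPQ hQP,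
    lowMat_pull hPQ, trForm_pull hPQ, trForm_pull hPQ]
  simp only [transpose_low, Matrix.mul_sub, Matrix.sub_mul]

theorem scal_pull (hPQ : P * Q = 1) (hQP : Q * P = 1) :
    (s.pull P Q).scal (Tensor12.pull P Q C) = s.scal C := by
  rw [scal_eq, scal_eq, ric_pull C s hPQ hQP, ginv_pull s hPQ, transpose_low, conj_mul_low hPQ,
    trace_conj hPQ]

theorem divK_pull (hPQ : P * Q = 1) : (s.pull P Q).divK (Tensor12.pull P Q C) = Pᵀ *ᵥ s.divK C := by
  rw [divK_eq, divK_eq, gam_pull C s hPQ, ginv_pull s hPQ, pull_k, swap_pull, transpose_up,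
    conj_mul_low hPQ, mixVec_pull hPQ, conVec_pull hPQ, transpose_low, low_mulVec hPQ,
    Matrix.mulVec_sub, Matrix.mulVec_neg]

theorem norm_pull (hPQ : P * Q = 1) (x y : Fin 3 → ℝ) (A : Mat3) :
    (Q *ᵥ x) ⬝ᵥ ((Pᵀ * A * P) *ᵥ (Q *ᵥ y)) = x ⬝ᵥ (A *ᵥ y) := by
  rw [low_mulVec hPQ, mulVec_dotProduct_cancel hPQ]

theorem u0_pull (hPQ : P * Q = 1) : (s.pull P Q).u0 = s.u0 := by
  rw [u0_eq, u0_eq, pull_g, pull_u, norm_pull hPQ]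

theorem u0Low_pull (hPQ : P * Q = 1) : (s.pull P Q).u0Low = s.u0Low := by
  rw [u0Low, u0Low, u0_pull s hPQ]

theorem uLow_pull (hPQ : P * Q = 1) : (s.pull P Q).uLow = Pᵀ *ᵥ s.uLow := by
  rw [uLow_eq, uLow_eq, pull_g, pull_u, low_mulVec hPQ]

theorem normE_pull (hPQ : P * Q = 1) : (s.pull P Q).normE = s.normE := by
  rw [normE_eq, normE_eq, pull_g, pull_E, norm_pull hPQ]

theorem normF_pull (hPQ : P * Q = 1) : (s.pull P Q).normF = s.normF := by
  rw [normF_eq, normF_eq, ginv_pull s hPQ, pull_F, transpose_up, transpose_low, conj_mul_low hPQ,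
    conj_mul_up hPQ, conj_mul_low hPQ, trace_conj hPQ]

theorem dotPhi_pull : (s.pull P Q).dotPhi = s.dotPhi := rfl

theorem T00_pull : (s.pull P Q).T00 m = s.T00 m := rfl

theorem T_pull : Matrix.of ((s.pull P Q).T m) = Pᵀ * Matrix.of (s.T m) * P := by
  rw [T_eq, T_eq, dotPhi_pull, pull_g, pull_Φ]
  simp

theorem tau00_pull (hPQ : P * Q = 1) : (s.pull P Q).tau00 = s.tau00 := by
  rw [tau00, tau00, normE_pull s hPQ, normF_pull s hPQ]

theorem tau0_pull (hPQ : P * Q = 1) : (s.pull P Q).tau0 = Pᵀ *ᵥ s.tau0 := by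
  rw [tau0_eq, tau0_eq, pull_F, pull_E, low_mulVec hPQ, Matrix.mulVec_neg]

theorem low_up_low (hPQ : P * Q = 1) (A B D : Mat3) :
    Pᵀ * A * P * (Q * B * Qᵀ) * (Pᵀ * D * P) = Pᵀ * (A * B * D) * P := by
  rw [Matrix.mul_assoc (Pᵀ * A * P), conj_mul_low hPQ, low_mul_conj hPQ, Matrix.mul_assoc A]

theorem vecMulVec_low (x y : Fin 3 → ℝ) :
    Matrix.vecMulVec (Pᵀ *ᵥ x) (Pᵀ *ᵥ y) = Pᵀ * Matrix.vecMulVec x y * P := by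
  rw [vecMulVec_conj, Matrix.transpose_transpose]

theorem tau_pull (hPQ : P * Q = 1) : Matrix.of (s.pull P Q).tau = Pᵀ * Matrix.of s.tau * P := by
  rw [tau_eq, tau_eq, normE_pull s hPQ, normF_pull s hPQ, ginv_pull s hPQ, pull_g, pull_F, pull_E,
    transpose_low, low_up_low hPQ, low_mulVec hPQ, vecMulVec_low]
  simp only [Matrix.mul_add, Matrix.mul_sub, Matrix.add_mul, Matrix.sub_mul, Matrix.mul_smul,
    Matrix.smul_mul]

theorem rhsG_pull : Matrix.of (s.pull P Q).rhsG = Pᵀ * Matrix.of s.rhsG * P := by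
  rw [rhsG_eq, rhsG_eq, pull_k]
  simp

theorem rhsK_pull (hPQ : P * Q = 1) (hQP : Q * P = 1) :
    Matrix.of ((s.pull P Q).rhsK (Tensor12.pull P Q C) m Λ)
    = Pᵀ * Matrix.of (s.rhsK C m Λ) * P := by
  rw [rhsK_eq, rhsK_eq, ric_pull C s hPQ hQP, H_pull s hPQ, pull_k, ginv_pull s hPQ,
    conj_mul_low hPQ, low_mul_conj hPQ, T_pull, tau_pull s hPQ, pull_ρ, pull_g, pull_u,
    low_mulVec hPQ, vecMulVec_low, T00_pull, u0Low_pull s hPQ, transpose_low, conj_mul_low hPQ,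
    trace_conj hPQ, up_mulVec hPQ, dotProduct_comm (Pᵀ *ᵥ _), mulVec_dotProduct_cancel hPQ,
    dotProduct_comm (s.ginv *ᵥ _)]
  simp only [Matrix.mul_add, Matrix.mul_sub, Matrix.add_mul, Matrix.sub_mul, Matrix.mul_smul,
    Matrix.smul_mul]

theorem rhsE_pull (hPQ : P * Q = 1) (hQP : Q * P = 1) :
    (s.pull P Q).rhsE (Tensor12.pull P Q C) = Q *ᵥ s.rhsE C := by
  rw [rhsE_eq, rhsE_eq, H_pull s hPQ, ginv_pull s hPQ, pull_F, pull_E, pull_u, pull_e, swap_pull,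
    transpose_low, transpose_up, mixVec_one_pull hPQ hQP, up_mulVec hPQ, low_mulVec hPQ,
    up_mulVec hPQ, conj_mul_low hPQ, conj_mul_up hPQ, conVec_pull hPQ]
  simp only [Matrix.mulVec_add, Matrix.mulVec_sub, Matrix.mulVec_smul]

theorem rhsF_pull (hPQ : P * Q = 1) : Matrix.of ((s.pull P Q).rhsF (Tensor12.pull P Q C))
    = Pᵀ * Matrix.of (s.rhsF C) * P := by
  rw [rhsF_eq, rhsF_eq, pull_g, pull_E, low_mulVec hPQ, lowMat_pull hPQ]

theorem rhsU_pull (hPQ : P * Q = 1) : (s.pull P Q).rhsU (Tensor12.pull P Q C) = Q *ᵥ s.rhsU C := by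
  rw [rhsU_eq, rhsU_eq, ginv_pull s hPQ, gam_pull C s hPQ, u0_pull s hPQ, pull_k, pull_u, pull_e,
    pull_ρ, pull_E, pull_F, transpose_low, low_mulVec hPQ, low_mulVec hPQ, up_mulVec hPQ,
    up_mulVec hPQ, vecMulVec_conj, conVec_pull hPQ]
  simp only [Matrix.mulVec_add, Matrix.mulVec_sub, Matrix.mulVec_smul]

theorem expansion_pull (hPQ : P * Q = 1) (hQP : Q * P = 1) :
    (s.pull P Q).expansion (Tensor12.pull P Q C) = s.expansion C := by
  rw [expansion_eq, expansion_eq, ginv_pull s hPQ, u0_pull s hPQ, pull_k, pull_u, norm_pull hPQ,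
    swap_pull, mixVec_one_pull hPQ hQP, dotProduct_comm (Pᵀ *ᵥ _), mulVec_dotProduct_cancel hPQ,
    dotProduct_comm s.u (mixVec _ _), conj_mul_low hPQ, trace_conj hPQ]

theorem work_pull (hPQ : P * Q = 1) : (s.pull P Q).work = s.work := by
  rw [work_eq, work_eq, u0_pull s hPQ, pull_g, pull_u, pull_E, norm_pull hPQ]

end State

/-! ### Structure constants and the Jacobi identity. -/

section

/-- The structure constants of a Lie algebra: antisymmetry and the Jacobi identity. -/
structure IsLieTensor (C : Tensor12) : Prop where
  antisymm : ∀ k i j, C k i j = -C k j i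
  jacobi : ∀ i j, C.slice i * C.slice j - C.slice j * C.slice i = ∑ l, C l i j • C.slice l

/-- `slice i` is the matrix of `ad e_i`, so the field `jacobi` says that `ad` is a representation:
`[ad e_i, ad e_j] = ad [e_i, e_j]`. -/
theorem isLieTensor_structureConst {𝔤 : Type*} [LieRing 𝔤] [LieAlgebra ℝ 𝔤]
    (b : Module.Basis (Fin 3) ℝ 𝔤) : IsLieTensor (structureConst b) where
  antisymm k i j := by
    rw [structureConst, structureConst, ← lie_skew, map_neg, Finsupp.neg_apply]
  jacobi i j := by
    have bracket (x : 𝔤) (i k : Fin 3) :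
        b.repr ⁅b i, x⁆ k = ∑ l, structureConst b k i l * b.repr x l := by
      calc b.repr ⁅b i, x⁆ k = b.repr ⁅b i, ∑ l, b.repr x l • b l⁆ k := by rw [b.sum_repr]
        _ = _ := by
          simp only [lie_sum, lie_smul, map_sum, map_smul, Finsupp.finsetSum_apply,
            Finsupp.smul_apply, smul_eq_mul, structureConst, mul_comm]
    ext m k
    have h := congrArg (fun x => b.repr x m) (leibniz_lie (b i) (b j) (b k))
    simp only [map_add, Finsupp.add_apply] at h
    rw [bracket ⁅b j, b k⁆ i m, bracket ⁅b i, b k⁆ j m, ← lie_skew ⁅b i, b j⁆ (b k), map_neg,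
      Finsupp.neg_apply, bracket] at h
    have skew (l : Fin 3) : structureConst b m k l = -structureConst b m l k := by
      rw [structureConst, structureConst, ← lie_skew, map_neg, Finsupp.neg_apply]
    simp only [Matrix.sub_apply, Matrix.mul_apply, Matrix.sum_apply, Matrix.smul_apply, slice,
      Matrix.of_apply, smul_eq_mul]
    simp only [skew] at h
    simp only [neg_mul, Finset.sum_neg_distrib, neg_neg] at h
    simp only [structureConst] at h ⊢
    rw [h]
    simp [mul_comm]

variable {C : Tensor12} {P Q : Mat3}

theorem IsLieTensor.pull (hC : IsLieTensor C) (hPQ : P * Q = 1) :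
    IsLieTensor (C.pull P Q) where
  antisymm k i j := by
    have h : C.swap = (-1 : ℝ) • C := by
      funext k i j
      simp [swap, hC.antisymm k j i]
    have := congrFun (congrFun (congrFun (swap_pull (P := P) (Q := Q) C) k) j) i
    rw [h, pull_smul] at this
    simpa [swap] using this
  jacobi i j := by
    -- Multiplying by `P` removes the factor `Q` on the upper index, so that the sum over the new
    -- frame on the right of `jacobi` turns into one over the old frame.
    have hP (d : Fin 3) :
        ∑ l, P d l * C.pull P Q l i j = ∑ b, ∑ c, P b i * P c j * C d b c := by
      have h : P * (C.pull P Q).slice i = ∑ b, P b i • (C.slice b * P) := by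
        rw [slice_pull, Matrix.mul_sum]
        refine Finset.sum_congr rfl fun b _ => ?_
        rw [Matrix.mul_smul, Matrix.mul_assoc Q, ← Matrix.mul_assoc P, hPQ, Matrix.one_mul]
      have h2 := congrFun (congrFun h d) j
      rw [Matrix.mul_apply] at h2
      refine h2.trans ?_
      simp only [Matrix.sum_apply, Matrix.smul_apply, Matrix.mul_apply, slice, Matrix.of_apply,
        smul_eq_mul, Finset.mul_sum]
      refine Finset.sum_congr rfl fun b _ => Finset.sum_congr rfl fun c _ => ?_
      ring
    have hR : ∑ l, C.pull P Q l i j • (C.pull P Q).slice l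
        = ∑ d, (∑ l, P d l * C.pull P Q l i j) • (Q * C.slice d * P) := by
      simp only [slice_pull, Finset.smul_sum, Finset.sum_smul, smul_smul]
      rw [Finset.sum_comm]
      refine Finset.sum_congr rfl fun b _ => Finset.sum_congr rfl fun c _ => ?_
      rw [mul_comm]
    have hL (i j : Fin 3) : (C.pull P Q).slice i * (C.pull P Q).slice j
        = ∑ b, ∑ c, (P b i * P c j) • (Q * (C.slice b * C.slice c) * P) := by
      simp only [slice_pull, Finset.sum_mul, Finset.mul_sum, Matrix.smul_mul, Matrix.mul_smul,
        mul_conj hPQ, smul_smul]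
      rw [Finset.sum_comm]
      refine Finset.sum_congr rfl fun b _ => Finset.sum_congr rfl fun c _ => ?_
      rw [mul_comm]
    rw [hR, hL, hL]
    conv_lhs => enter [2]; rw [Finset.sum_comm]
    rw [← Finset.sum_sub_distrib]
    simp only [← Finset.sum_sub_distrib]
    simp only [mul_comm (P _ j) (P _ i), ← smul_sub, ← Matrix.sub_mul, ← Matrix.mul_sub,
      hC.jacobi, hP, Finset.sum_smul]
    simp only [Finset.mul_sum, Finset.sum_mul, Finset.smul_sum, Matrix.mul_smul, Matrix.smul_mul,
      smul_smul]
    conv_rhs => rw [Finset.sum_comm]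
    refine Finset.sum_congr rfl fun b _ => ?_
    rw [Finset.sum_comm]

/-- The exterior derivative of the magnetic part of the electromagnetic field. -/
def magnetic (C : Tensor12) (F : Mat3) (i j k : Fin 3) : ℝ :=
  (∑ l, C l i j * F k l) + (∑ l, C l k i * F j l) + (∑ l, C l j k * F i l)

theorem magnetic_pull (hPQ : P * Q = 1) (F : Mat3) (i j k : Fin 3) :
    magnetic (C.pull P Q) (Pᵀ * F * P) i j k
      = ∑ a, ∑ b, ∑ c, P a i * P b j * P c k * magnetic C F a b c := by
  have key (i j k : Fin 3) : ∑ l, C.pull P Q l i j * (Pᵀ * F * P) k l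
      = ∑ a, ∑ b, ∑ c, P a i * P b j * P c k * ∑ l, C l a b * F c l := by
    have h : Pᵀ * F * P * (C.pull P Q).slice i = ∑ a, P a i • (Pᵀ * (F * C.slice a) * P) := by
      rw [slice_pull, Matrix.mul_sum]
      refine Finset.sum_congr rfl fun a _ => ?_
      rw [Matrix.mul_smul, State.low_mul_conj hPQ]
    have h2 := congrFun (congrFun h k) j
    rw [Matrix.mul_apply] at h2
    calc _ = ∑ l, (Pᵀ * F * P) k l * (C.pull P Q).slice i l j :=
          Finset.sum_congr rfl fun l _ => mul_comm _ _
      _ = _ := h2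
      _ = _ := by
        simp only [Matrix.sum_apply, Matrix.smul_apply, Matrix.mul_apply, slice, Matrix.of_apply,
          smul_eq_mul, Matrix.transpose_apply, Finset.sum_mul, Finset.mul_sum]
        refine Finset.sum_congr rfl fun a _ => Finset.sum_congr rfl fun b _ =>
          Finset.sum_congr rfl fun c _ => Finset.sum_congr rfl fun l _ => ?_
        ring
  rw [magnetic, key, key, key]
  simp only [magnetic, Fin.sum_univ_three]
  ring

end

/-- `IsSolutionOn` at a single time. -/
structure IsSolutionAt (C : Tensor12) (m Λ : ℝ) (s : ℝ → State) (I : Set ℝ) (t : ℝ) : Prop where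
  admissible : (s t).Admissible
  eq_g : ∀ i j, HasDerivWithinAt (fun r => (s r).g i j) ((s t).rhsG i j) I t
  eq_k : ∀ i j, HasDerivWithinAt (fun r => (s r).k i j) ((s t).rhsK C m Λ i j) I t
  eq_E : ∀ i, HasDerivWithinAt (fun r => (s r).E i) ((s t).rhsE C i) I t
  eq_F : ∀ i j, HasDerivWithinAt (fun r => (s r).F i j) ((s t).rhsF C i j) I t
  eq_u : ∀ i, HasDerivWithinAt (fun r => (s r).u i) ((s t).rhsU C i) I t
  eq_Phi : HasDerivWithinAt (fun r => (s r).Φ) (√(2 * (s t).U)) I t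
  eq_U : HasDerivWithinAt (fun r => (s r).U)
    (2 * (s t).H * (s t).U - m ^ 2 * (s t).Φ * √(2 * (s t).U)) I t
  eq_rho : HasDerivWithinAt (fun r => (s r).ρ)
    (-(s t).expansion C * (s t).ρ + 4 * Real.pi * (s t).e * (s t).work) I t
  eq_e : HasDerivWithinAt (fun r => (s r).e)
    (-(s t).expansion C * (s t).e + 4 * Real.pi * (s t).work * ((s t).e ^ 2 / (s t).ρ)) I t

theorem IsSolutionOn.isSolutionAt {C : Tensor12} {m Λ : ℝ} {s : ℝ → State} {I : Set ℝ}
    (h : IsSolutionOn C m Λ s I) {t : ℝ} (ht : t ∈ I) : IsSolutionAt C m Λ s I t where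
  admissible := h.admissible t ht
  eq_g := h.eq_g t ht
  eq_k := h.eq_k t ht
  eq_E := h.eq_E t ht
  eq_F := h.eq_F t ht
  eq_u := h.eq_u t ht
  eq_Phi := h.eq_Phi t ht
  eq_U := h.eq_U t ht
  eq_rho := h.eq_rho t ht
  eq_e := h.eq_e t ht

section Calculus

variable {I : Set ℝ} {t : ℝ}

theorem hasDerivWithinAt_mulVec (A : Mat3) {x : ℝ → Fin 3 → ℝ} {x' : Fin 3 → ℝ}
    (h : ∀ i, HasDerivWithinAt (fun r => x r i) (x' i) I t) (i : Fin 3) :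
    HasDerivWithinAt (fun r => (A *ᵥ x r) i) ((A *ᵥ x') i) I t := by
  simp only [Matrix.mulVec, dotProduct]
  exact HasDerivWithinAt.fun_sum fun j _ => (h j).const_mul _

theorem hasDerivWithinAt_low (P : Mat3) {A : ℝ → Mat3} {A' : Mat3}
    (h : ∀ i j, HasDerivWithinAt (fun r => A r i j) (A' i j) I t) (i j : Fin 3) :
    HasDerivWithinAt (fun r => (Pᵀ * A r * P) i j) ((Pᵀ * A' * P) i j) I t := by
  simp only [Matrix.mul_apply]
  exact HasDerivWithinAt.fun_sum fun a _ =>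
    (HasDerivWithinAt.fun_sum fun b _ => (h b a).const_mul _).mul_const _

theorem differentiableWithinAt_inv_apply {A : ℝ → Mat3}
    (h : ∀ i j, DifferentiableWithinAt ℝ (fun r => A r i j) I t) (hdet : (A t).det ≠ 0)
    (i j : Fin 3) : DifferentiableWithinAt ℝ (fun r => (A r)⁻¹ i j) I t := by
  have hadj : DifferentiableWithinAt ℝ (fun r => (A r).adjugate i j) I t := by
    simp only [Matrix.adjugate_fin_three]
    fin_cases i <;> fin_cases j <;> simp <;> fun_prop
  have hd : DifferentiableWithinAt ℝ (fun r => (A r).det) I t := by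
    simp only [Matrix.det_fin_three]
    fun_prop
  have : (fun r => (A r)⁻¹ i j) = fun r => (A r).det⁻¹ * (A r).adjugate i j := by
    funext r
    rw [Matrix.inv_def, Ring.inverse_eq_inv', Matrix.smul_apply, smul_eq_mul]
  rw [this]
  exact (hd.inv hdet).mul hadj

/-- In `A⁻¹ = 2 - A + (A - 1) A⁻¹ (A - 1)` the last term is of second order at a point where `A =
1`, so only the differentiability of `A⁻¹` is needed, not its derivative. Invertibility is required
on all of `I` for the identity to hold near `t`. -/
theorem hasDerivWithinAt_inv_of_eq_one {A : ℝ → Mat3} {A' : Mat3}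
    (h : ∀ i j, HasDerivWithinAt (fun r => A r i j) (A' i j) I t)
    (hdet : ∀ r ∈ I, (A r).det ≠ 0) (ht : t ∈ I) (h1 : A t = 1) (i j : Fin 3) :
    HasDerivWithinAt (fun r => (A r)⁻¹ i j) (-A' i j) I t := by
  have key (r : ℝ) (hr : r ∈ I) :
      (A r)⁻¹ = (2 : ℝ) • 1 - A r + (A r - 1) * ((A r)⁻¹ * (A r - 1)) := by
    have h2 : (A r)⁻¹ * A r = 1 := Matrix.nonsing_inv_mul _ (hdet r hr).isUnit
    have h3 : A r * (A r)⁻¹ = 1 := Matrix.mul_nonsing_inv _ (hdet r hr).isUnit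
    simp only [mul_sub, sub_mul, h2, h3, mul_one, one_mul, two_smul]
    abel
  have hA (a b : Fin 3) : HasDerivWithinAt (fun r => (A r - 1) a b) (A' a b) I t := by
    exact (h a b).sub_const ((1 : Mat3) a b)
  have hinv (a b : Fin 3) :
      HasDerivWithinAt (fun r => (A r)⁻¹ a b) (derivWithin (fun r => (A r)⁻¹ a b) I t) I t :=
    (differentiableWithinAt_inv_apply (fun i j => (h i j).differentiableWithinAt)
      (hdet t ht) a b).hasDerivWithinAt
  have hprod : HasDerivWithinAt (fun r => ((A r - 1) * ((A r)⁻¹ * (A r - 1))) i j) 0 I t := by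
    simp only [Matrix.mul_apply]
    have := HasDerivWithinAt.fun_sum (u := Finset.univ) fun a (_ : a ∈ Finset.univ) =>
      (hA i a).fun_mul (HasDerivWithinAt.fun_sum (u := Finset.univ)
        fun b (_ : b ∈ Finset.univ) => (hinv a b).fun_mul (hA b j))
    exact this.congr_deriv (by simp [h1])
  have := (((h i j).const_sub (((2 : ℝ) • (1 : Mat3)) i j)).add hprod).congr_of_mem
    (fun r hr => congrFun (congrFun (key r hr) i) j) ht
  simpa using this

end Calculus

/-! ### Frames orthonormal at a given time. -/

theorem posDef_pull {g P Q : Mat3} (hg : g.PosDef) (hPQ : P * Q = 1) :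
    (Pᵀ * g * P).PosDef := by
  have hP : Function.Injective P.mulVec := by
    have hQP : Q * P = 1 := mul_eq_one_comm.mp hPQ
    intro x y h
    have := congrArg (Q *ᵥ ·) h
    simpa [Matrix.mulVec_mulVec, hQP] using this
  have := hg.conjTranspose_mul_mul_same hP
  rwa [Matrix.conjTranspose_eq_transpose_of_trivial] at this

open scoped MatrixOrder in
theorem exists_orthonormal_frame {g : Mat3} (hg : g.PosDef) :
    ∃ P Q : Mat3, P * Q = 1 ∧ Q * P = 1 ∧ Pᵀ * g * P = 1 := by
  -- Factor `g = Qᵀ Q`; the frame `P = Q⁻¹` then satisfies `Pᵀ g P = 1`.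
  obtain ⟨Q, hQ⟩ := CStarAlgebra.nonneg_iff_eq_star_mul_self.mp hg.posSemidef.nonneg
  rw [Matrix.star_eq_conjTranspose, Matrix.conjTranspose_eq_transpose_of_trivial] at hQ
  have hdet : IsUnit Q.det := by
    have := hg.det_pos.ne'
    rw [hQ, Matrix.det_mul, Matrix.det_transpose] at this
    exact (left_ne_zero_of_mul this).isUnit
  have hPQ : Q⁻¹ * Q = 1 := Matrix.nonsing_inv_mul Q hdet
  have hQP : Q * Q⁻¹ = 1 := Matrix.mul_nonsing_inv Q hdet
  refine ⟨Q⁻¹, Q, hPQ, hQP, ?_⟩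
  rw [hQ, Matrix.mul_assoc, Matrix.mul_assoc, hQP, Matrix.mul_one, ← Matrix.transpose_mul, hQP,
    Matrix.transpose_one]

theorem State.Admissible.pull {s : State} (h : s.Admissible) {P Q : Mat3} (hPQ : P * Q = 1) :
    (s.pull P Q).Admissible where
  g_posDef := posDef_pull h.g_posDef hPQ
  k_symm := by
    rw [Matrix.IsSymm, State.pull_k, State.transpose_low, h.k_symm]
  F_antisymm := by
    rw [State.pull_F, State.transpose_low, h.F_antisymm, Matrix.mul_neg, Matrix.neg_mul]
  U_nonneg := h.U_nonneg
  rho_pos := h.rho_pos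

theorem IsSolutionAt.pull {C : Tensor12} {m Λ : ℝ} {s : ℝ → State} {I : Set ℝ} {t : ℝ}
    (h : IsSolutionAt C m Λ s I t) {P Q : Mat3} (hPQ : P * Q = 1) (hQP : Q * P = 1) :
    IsSolutionAt (C.pull P Q) m Λ (fun r => (s r).pull P Q) I t where
  admissible := h.admissible.pull hPQ
  eq_g i j := by
    have := hasDerivWithinAt_low P (A' := Matrix.of (s t).rhsG) h.eq_g i j
    rwa [← State.rhsG_pull (Q := Q)] at this
  eq_k i j := by
    have := hasDerivWithinAt_low P (A' := Matrix.of ((s t).rhsK C m Λ)) h.eq_k i j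
    rwa [← State.rhsK_pull C m Λ (s t) hPQ hQP] at this
  eq_E i := by
    have := hasDerivWithinAt_mulVec Q h.eq_E i
    rwa [← State.rhsE_pull C (s t) hPQ hQP] at this
  eq_F i j := by
    have := hasDerivWithinAt_low P (A' := Matrix.of ((s t).rhsF C)) h.eq_F i j
    rwa [← State.rhsF_pull C (s t) hPQ] at this
  eq_u i := by
    have := hasDerivWithinAt_mulVec Q h.eq_u i
    rwa [← State.rhsU_pull C (s t) hPQ] at this
  eq_Phi := h.eq_Phi
  eq_U := by
    rw [State.H_pull _ hPQ]
    exact h.eq_U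
  eq_rho := by
    rw [State.expansion_pull C _ hPQ hQP, State.work_pull _ hPQ]
    exact h.eq_rho
  eq_e := by
    rw [State.expansion_pull C _ hPQ hQP, State.work_pull _ hPQ]
    exact h.eq_e

/-! ### Uniqueness for scalar linear equations. -/

/-- A solution of a scalar linear homogeneous equation that vanishes at a point vanishes. -/
theorem eq_zero_of_hasDerivWithinAt_mul_self {I : Set ℝ} (hI : I.OrdConnected) {f a : ℝ → ℝ}
    (ha : ContinuousOn a I) (hf : ∀ t ∈ I, HasDerivWithinAt f (a t * f t) I t) {t₀ : ℝ}
    (h₀ : t₀ ∈ I) (hf₀ : f t₀ = 0) {t : ℝ} (ht : t ∈ I) : f t = 0 := by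
  -- Forward in time: the coefficient is bounded on the compact interval `[x, y]`, and Grönwall's
  -- inequality applies.
  have forward {J : Set ℝ} (hJ : J.OrdConnected) {f a : ℝ → ℝ} (ha : ContinuousOn a J)
      (hf : ∀ t ∈ J, HasDerivWithinAt f (a t * f t) J t) {x y : ℝ} (hx : x ∈ J) (hy : y ∈ J)
      (hxy : x ≤ y) (h0 : f x = 0) : f y = 0 := by
    have hsub : Set.Icc x y ⊆ J := hJ.out hx hy
    obtain ⟨K, hK⟩ := isCompact_Icc.exists_bound_of_continuousOn (ha.mono hsub)
    refine eq_zero_of_abs_deriv_le_mul_abs_self_of_eq_zero_right (f' := fun t => a t * f t)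
      (K := K) (a := x) (b := y)
      (fun t ht => ((hf t (hsub ht)).continuousWithinAt).mono hsub) ?_ h0 ?_ y ⟨hxy, le_rfl⟩
    · intro z hz
      have h1 := (hf z (hsub ⟨hz.1, hz.2.le⟩)).mono hsub
      exact h1.mono_of_mem_nhdsWithin (Icc_mem_nhdsGE_of_mem hz)
    · intro z hz
      rw [norm_mul]
      exact mul_le_mul_of_nonneg_right (hK z ⟨hz.1, hz.2.le⟩) (norm_nonneg _)
  rcases le_total t₀ t with h | h
  · exact forward hI ha hf h₀ ht h hf₀
  -- Backward in time: the reflection `r ↦ -r` gives an equation of the same form with coefficient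
  -- `-a (-r)`.
  · have hcont : ContinuousOn (fun r => -a (-r)) (-I) :=
      (ha.comp continuous_neg.continuousOn fun r hr => hr).neg
    have hder : ∀ r ∈ -I, HasDerivWithinAt (fun r => f (-r)) (-a (-r) * f (-r)) (-I) r := by
      intro r hr
      have h1 : HasDerivWithinAt (fun r : ℝ => -r) (-1) (-I) r := (hasDerivWithinAt_id r _).neg
      have h2 := (hf (-r) hr).comp r h1 fun x hx => hx
      exact h2.congr_deriv (by ring)
    have hord : (-I).OrdConnected := by
      refine ⟨fun x hx y hy z hz => ?_⟩
      exact hI.out hy hx ⟨neg_le_neg hz.2, neg_le_neg hz.1⟩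
    have := forward hord hcont hder (x := -t₀) (y := -t) (by simpa) (by simpa) (by linarith)
      (by simpa)
    simpa using this

section

/-! ### Calculus of left invariant tensors in an orthonormal frame -/

/-- The rotation coefficients in an orthonormal frame. -/
def conn (C : Tensor12) (l i j : Fin 3) : ℝ := (1 / 2) * (-C i j l + C j l i + C l i j)

/-- The Ricci tensor in an orthonormal frame. -/
def oric (C : Tensor12) (i j : Fin 3) : ℝ :=
  (∑ l, ∑ n, conn C l l n * conn C n j i) - (∑ l, ∑ n, conn C n j l * conn C l n i)
    - ∑ l, ∑ n, C l n j * conn C n l i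

/-- The covariant derivative `∇_l k_{ij}` in an orthonormal frame. -/
def ocov (C : Tensor12) (k : Mat3) (l i j : Fin 3) : ℝ :=
  -(∑ n, conn C n l i * k n j) - ∑ n, conn C n l j * k i n

/-- The divergence `∇^i k_{ij}` in an orthonormal frame. -/
def odiv (C : Tensor12) (k : Mat3) (j : Fin 3) : ℝ := ∑ i, ocov C k i i j

/-- The rate of change of the connection under `dg_{ij}/dt = -2k_{ij}`. -/
def dconn (C : Tensor12) (k : Mat3) (l i j : Fin 3) : ℝ :=
  -ocov C k i j l - ocov C k j i l + ocov C k l i j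

theorem IsLieTensor.self {C : Tensor12} (hC : IsLieTensor C) (l i : Fin 3) : C l i i = 0 := by
  linarith [hC.antisymm l i i]

/-- The components of a tensor antisymmetric in its lower indices, reduced to independent ones. -/
theorem IsLieTensor.reduce {C : Tensor12} (hC : IsLieTensor C) :
    (∀ l, C l 0 0 = 0) ∧ (∀ l, C l 1 1 = 0) ∧ (∀ l, C l 2 2 = 0) ∧ (∀ l, C l 1 0 = -C l 0 1)
      ∧ (∀ l, C l 2 0 = -C l 0 2) ∧ (∀ l, C l 2 1 = -C l 1 2) :=
  ⟨fun l => hC.self l 0, fun l => hC.self l 1, fun l => hC.self l 2, fun l => hC.antisymm l 1 0,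
    fun l => hC.antisymm l 2 0, fun l => hC.antisymm l 2 1⟩

theorem isSymm_reduce {k : Mat3} (hk : k.IsSymm) :
    k 1 0 = k 0 1 ∧ k 2 0 = k 0 2 ∧ k 2 1 = k 1 2 :=
  ⟨hk.apply 0 1, hk.apply 0 2, hk.apply 1 2⟩

/-- A metric that equals the identity at `t` and has rate of change `-2k` there. -/
structure IsOrthonormalAt (s : ℝ → State) (I : Set ℝ) (t : ℝ) : Prop where
  mem : t ∈ I
  det_ne : ∀ r ∈ I, (s r).g.det ≠ 0
  g_eq : (s t).g = 1
  k_symm : (s t).k.IsSymm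
  eq_g : ∀ i j, HasDerivWithinAt (fun r => (s r).g i j) (-2 * (s t).k i j) I t

theorem ginv_of_g_eq_one {s : State} (h : s.g = 1) : s.ginv = 1 := by
  rw [State.ginv, h, inv_one]

theorem gam_of_g_eq_one {s : State} (h : s.g = 1) (C : Tensor12) (l i j : Fin 3) :
    s.gam C l i j = conn C l i j := by
  simp [State.gam, conn, ginv_of_g_eq_one h, h, Matrix.one_apply]

theorem ric_of_g_eq_one {s : State} (h : s.g = 1) (C : Tensor12) (i j : Fin 3) :
    s.ric C i j = oric C i j := by
  simp only [State.ric, oric, gam_of_g_eq_one h]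

theorem divK_of_g_eq_one {s : State} (h : s.g = 1) (C : Tensor12) (j : Fin 3) :
    s.divK C j = odiv C s.k j := by
  simp [State.divK, State.covK, odiv, ocov, gam_of_g_eq_one h, ginv_of_g_eq_one h,
    Matrix.one_apply]

variable {C : Tensor12} {s : ℝ → State} {I : Set ℝ} {t : ℝ}

theorem IsOrthonormalAt.ginv (h : IsOrthonormalAt s I t) (i j : Fin 3) :
    HasDerivWithinAt (fun r => (s r).ginv i j) (2 * (s t).k i j) I t := by
  have := hasDerivWithinAt_inv_of_eq_one (A' := (-2 : ℝ) • (s t).k) (by simpa using h.eq_g)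
    h.det_ne h.mem h.g_eq i j
  exact this.congr_deriv (by simp)

/-- The right side is what the product rule yields from `γ = g⁻¹ · (Koszul terms)`. The equality
says that the variation of a Levi-Civita connection is a tensor made of covariant derivatives of
`k`. It is checked component by component in the independent entries of `C` and `k`. -/
theorem dconn_eq (hC : IsLieTensor C) {k : Mat3} (hk : k.IsSymm) (l i j : Fin 3) :
    dconn C k l i j = 2 * (∑ n, k l n * conn C n i j)
      - (-(∑ p, C p j l * k i p) + (∑ p, C p l i * k j p) + ∑ p, C p i j * k l p) := by
  obtain ⟨h1, h2, h3, h4, h5, h6⟩ := hC.reduce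
  obtain ⟨k1, k2, k3⟩ := isSymm_reduce hk
  simp only [dconn, ocov, conn, Fin.sum_univ_three]
  fin_cases l <;> fin_cases i <;> fin_cases j <;>
    simp only [Fin.zero_eta, Fin.mk_one, Fin.reduceFinMk, h1, h2, h3, h4, h5, h6, k1, k2, k3] <;>
    ring

theorem IsOrthonormalAt.gam (h : IsOrthonormalAt s I t) (hC : IsLieTensor C) (l i j : Fin 3) :
    HasDerivWithinAt (fun r => (s r).gam C l i j) (dconn C (s t).k l i j) I t := by
  have hX (n : Fin 3) := ((HasDerivWithinAt.fun_sum (u := Finset.univ) fun p _ =>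
      (h.eq_g i p).const_mul (C p j n)).neg.add
    (HasDerivWithinAt.fun_sum (u := Finset.univ) fun p _ =>
      (h.eq_g j p).const_mul (C p n i))).add
    (HasDerivWithinAt.fun_sum (u := Finset.univ) fun p _ =>
      (h.eq_g n p).const_mul (C p i j))
  have := (HasDerivWithinAt.fun_sum (u := Finset.univ) fun n _ =>
    (h.ginv l n).fun_mul (hX n)).const_mul (1 / 2)
  refine this.congr_deriv ?_
  rw [dconn_eq hC h.k_symm]
  simp only [ginv_of_g_eq_one h.g_eq, h.g_eq, conn, Matrix.one_apply, Fin.sum_univ_three,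
    Pi.add_apply, Pi.neg_apply]
  fin_cases l <;> fin_cases i <;> fin_cases j <;> simp <;> ring

end

/-! ### Rates of change of curvature and divergence when the metric varies by `-2k`. -/

section

variable {C : Tensor12} {s : ℝ → State} {I : Set ℝ} {t : ℝ}

/-- The rate of change of the Ricci tensor for given rates of change `D` of the connection. -/
def dric (C γ D : Tensor12) (i j : Fin 3) : ℝ :=
  (∑ l, ∑ n, (D l l n * γ n j i + γ l l n * D n j i))
    - (∑ l, ∑ n, (D n j l * γ l n i + γ n j l * D l n i)) - ∑ l, ∑ n, C l n j * D n l i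

/-- The trace `C^i_{ij}`. -/
def trC (C : Tensor12) (j : Fin 3) : ℝ := ∑ i, C i i j

theorem IsOrthonormalAt.ric (h : IsOrthonormalAt s I t) (hC : IsLieTensor C) (i j : Fin 3) :
    HasDerivWithinAt (fun r => (s r).ric C i j)
      (dric C (conn C) (dconn C (s t).k) i j) I t := by
  have h1 := HasDerivWithinAt.fun_sum (u := Finset.univ) fun l _ =>
    HasDerivWithinAt.fun_sum (u := Finset.univ) fun n _ =>
      (h.gam hC l l n).fun_mul (h.gam hC n j i)
  have h2 := HasDerivWithinAt.fun_sum (u := Finset.univ) fun l _ =>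
    HasDerivWithinAt.fun_sum (u := Finset.univ) fun n _ =>
      (h.gam hC n j l).fun_mul (h.gam hC l n i)
  have h3 := HasDerivWithinAt.fun_sum (u := Finset.univ) fun l _ =>
    HasDerivWithinAt.fun_sum (u := Finset.univ) fun n _ =>
      (h.gam hC n l i).const_mul (C l n j)
  refine ((h1.sub h2).sub h3).congr_deriv ?_
  simp only [dric, gam_of_g_eq_one h.g_eq]

theorem conn_antisymm (hC : IsLieTensor C) (l i j : Fin 3) : conn C l i j = -conn C j i l := by
  simp only [conn]
  rw [hC.antisymm l i j, hC.antisymm i j l, hC.antisymm j l i]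
  ring

theorem conn_torsion (hC : IsLieTensor C) (l i j : Fin 3) :
    C l i j = conn C l i j - conn C l j i := by
  simp only [conn]
  rw [hC.antisymm l j i, hC.antisymm i l j, hC.antisymm j i l]
  ring

/-- This is the variation of scalar curvature due to the connection, a pure divergence. With `γ`
metric and `C` its torsion-free bracket, the terms in which `D` is not traced cancel against each
other. -/
theorem trace_dric {C γ D : Tensor12} (hγ : ∀ l i j, γ l i j = -γ j i l)
    (hC : ∀ l i j, C l i j = γ l i j - γ l j i) (hD : ∀ l i j, D l i j = D l j i) :
    ∑ i, dric C γ D i i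
      = ∑ n, ((∑ l, D l l n) * ∑ i, γ n i i) + ∑ n, ((∑ l, γ l l n) * ∑ i, D n i i) := by
  have γ1 (i : Fin 3) : γ 0 i 0 = 0 := by linarith [hγ 0 i 0]
  have γ2 (i : Fin 3) : γ 1 i 1 = 0 := by linarith [hγ 1 i 1]
  have γ3 (i : Fin 3) : γ 2 i 2 = 0 := by linarith [hγ 2 i 2]
  have γ4 (i : Fin 3) : γ 1 i 0 = -γ 0 i 1 := hγ 1 i 0
  have γ5 (i : Fin 3) : γ 2 i 0 = -γ 0 i 2 := hγ 2 i 0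
  have γ6 (i : Fin 3) : γ 2 i 1 = -γ 1 i 2 := hγ 2 i 1
  have D1 (l : Fin 3) : D l 1 0 = D l 0 1 := hD l 1 0
  have D2 (l : Fin 3) : D l 2 0 = D l 0 2 := hD l 2 0
  have D3 (l : Fin 3) : D l 2 1 = D l 1 2 := hD l 2 1
  simp only [dric, hC, Fin.sum_univ_three, γ1, γ2, γ3, γ4, γ5, γ6, D1, D2, D3]
  ring

theorem dconn_symm {k : Mat3} (hk : k.IsSymm) (l i j : Fin 3) :
    dconn C k l i j = dconn C k l j i := by
  have : ocov C k l i j = ocov C k l j i := by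
    have h (a b c : Fin 3) : ∑ n, conn C n a b * k n c = ∑ n, conn C n a b * k c n :=
      Finset.sum_congr rfl fun n _ => by rw [hk.apply]
    rw [ocov, ocov, h, h]
    ring
  simp only [dconn, this]
  ring

/-- The first trace is minus the gradient of `tr k`, which is zero because `tr k` is constant on the
group; the same gradient drops out of the second trace. -/
theorem dconn_contract (hC : IsLieTensor C) {k : Mat3} (hk : k.IsSymm) (n : Fin 3) :
    ∑ l, dconn C k l l n = 0 ∧ ∑ i, dconn C k n i i = -2 * odiv C k n := by
  obtain ⟨h1, h2, h3, h4, h5, h6⟩ := hC.reduce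
  obtain ⟨k1, k2, k3⟩ := isSymm_reduce hk
  simp only [dconn, odiv, ocov, conn, Fin.sum_univ_three]
  fin_cases n <;>
    simp only [Fin.zero_eta, Fin.mk_one, Fin.reduceFinMk, h1, h2, h3, h4, h5, h6, k1, k2, k3] <;>
    constructor <;> ring

/-- The first sum is the divergence of the left invariant field `e_n`; hence `trC` appears wherever
a vector is differentiated to a scalar. -/
theorem conn_contract (hC : IsLieTensor C) (n : Fin 3) :
    ∑ l, conn C l l n = trC C n ∧ ∑ i, conn C n i i = -trC C n := by
  obtain ⟨h1, h2, h3, h4, h5, h6⟩ := hC.reduce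
  simp only [trC, conn, Fin.sum_univ_three]
  fin_cases n <;>
    simp only [Fin.zero_eta, Fin.mk_one, Fin.reduceFinMk, h1, h2, h3, h4, h5, h6] <;>
    constructor <;> ring

theorem IsOrthonormalAt.scal (h : IsOrthonormalAt s I t) (hC : IsLieTensor C) :
    HasDerivWithinAt (fun r => (s r).scal C)
      (2 * (∑ i, ∑ j, (s t).k i j * oric C i j)
        - 2 * ∑ n, trC C n * odiv C (s t).k n) I t := by
  have h1 := HasDerivWithinAt.fun_sum (u := Finset.univ) fun i _ =>
    HasDerivWithinAt.fun_sum (u := Finset.univ) fun j _ =>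
      (h.ginv i j).fun_mul (h.ric hC i j)
  refine h1.congr_deriv ?_
  have h2 : ∑ i, dric C (conn C) (dconn C (s t).k) i i
      = - (2 * ∑ n, trC C n * odiv C (s t).k n) := by
    rw [trace_dric (conn_antisymm hC) (conn_torsion hC) (dconn_symm h.k_symm)]
    simp only [(dconn_contract hC h.k_symm _).1, (dconn_contract hC h.k_symm _).2,
      (conn_contract hC _).1, Fin.sum_univ_three]
    ring
  rw [sub_eq_add_neg, ← h2]
  simp only [ric_of_g_eq_one h.g_eq, ginv_of_g_eq_one h.g_eq, Matrix.one_apply, ite_mul, one_mul,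
    zero_mul, Finset.sum_add_distrib, Finset.sum_ite_eq, Finset.mem_univ, if_true, mul_assoc,
    Finset.mul_sum]

/-- Two of the three terms of `dconn` cancel by symmetry of `k`; the third contributes minus half
the gradient of `|k|²`, a constant on the group. -/
theorem dconn_contract_self (hC : IsLieTensor C) {k : Mat3} (hk : k.IsSymm) (j : Fin 3) :
    ∑ i, ∑ n, dconn C k n i j * k i n = 0 := by
  obtain ⟨h1, h2, h3, h4, h5, h6⟩ := hC.reduce
  obtain ⟨k1, k2, k3⟩ := isSymm_reduce hk
  simp only [dconn, ocov, conn, Fin.sum_univ_three]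
  fin_cases j <;>
    simp only [Fin.zero_eta, Fin.mk_one, Fin.reduceFinMk, h1, h2, h3, h4, h5, h6, k1, k2, k3] <;>
    ring

/-- The divergence of the second fundamental form, when its rate of change is `Z`. -/
theorem IsOrthonormalAt.divK (h : IsOrthonormalAt s I t) (hC : IsLieTensor C) {Z : Mat3}
    (hk : ∀ i j, HasDerivWithinAt (fun r => (s r).k i j) (Z i j) I t) (j : Fin 3) :
    HasDerivWithinAt (fun r => (s r).divK C j)
      (2 * (∑ n, odiv C (s t).k n * (s t).k n j)
        + 2 * (∑ i, ∑ l, (s t).k i l * ocov C (s t).k l i j) + odiv C Z j) I t := by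
  have hcov (l i : Fin 3) := (HasDerivWithinAt.fun_sum (u := Finset.univ) fun n _ =>
      (h.gam hC n l i).fun_mul (hk n j)).neg.sub
    (HasDerivWithinAt.fun_sum (u := Finset.univ) fun n _ =>
      (h.gam hC n l j).fun_mul (hk i n))
  have h1 := HasDerivWithinAt.fun_sum (u := Finset.univ) fun i _ =>
    HasDerivWithinAt.fun_sum (u := Finset.univ) fun l _ =>
      (h.ginv i l).fun_mul (hcov l i)
  refine h1.congr_deriv ?_
  have h2 (n : Fin 3) := (dconn_contract hC h.k_symm n).2
  have h3 := dconn_contract_self hC h.k_symm j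
  simp only [Fin.sum_univ_three] at h2 h3
  have h20 := h2 0
  have h21 := h2 1
  have h22 := h2 2
  simp only [odiv] at h20 h21 h22 ⊢
  simp only [ocov, gam_of_g_eq_one h.g_eq, ginv_of_g_eq_one h.g_eq, Matrix.one_apply,
    Fin.sum_univ_three, Pi.neg_apply, Pi.sub_apply] at h20 h21 h22 ⊢
  simp
  linear_combination (-(s t).k 0 j) * h20 - (s t).k 1 j * h21 - (s t).k 2 j * h22 - h3

end

/-! ### Divergence identities for left invariant tensors. -/

section

variable {C : Tensor12}

/-- In dimension three the Jacobi identity has content only for the triple `e_0, e_1, e_2`, one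
equation for each upper index. -/
theorem IsLieTensor.jacobi_reduce (hC : IsLieTensor C) (m : Fin 3) :
    ∑ l, (C m 0 l * C l 1 2 - C m 1 l * C l 0 2 - C l 0 1 * C m l 2) = 0 := by
  have h := congrFun (congrFun (hC.jacobi 0 1) m) 2
  simp only [slice, Matrix.sub_apply, Matrix.mul_apply, Matrix.sum_apply, Matrix.smul_apply,
    Matrix.of_apply, smul_eq_mul] at h
  simp only [Finset.sum_sub_distrib, h, sub_self]

set_option maxHeartbeats 1000000 in
/-- The contracted Bianchi identity for a left invariant metric. -/
theorem odiv_oric (hC : IsLieTensor C) (j : Fin 3) : odiv C (Matrix.of (oric C)) j = 0 := by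
  obtain ⟨h1, h2, h3, h4, h5, h6⟩ := hC.reduce
  have J0 := hC.jacobi_reduce 0
  have J1 := hC.jacobi_reduce 1
  have J2 := hC.jacobi_reduce 2
  simp only [Fin.sum_univ_three, h1, h2, h3, h4] at J0 J1 J2
  simp only [odiv, ocov, oric, conn, Fin.sum_univ_three, Matrix.of_apply]
  fin_cases j
  · simp only [Fin.zero_eta, h1, h2, h3, h4, h5, h6]
    -- The divergence equals half the gradient of the scalar curvature, hence zero. As a cubic
    -- polynomial in the nine independent structure constants, it is a combination of the quadratic
    -- Jacobi relations with linear coefficients.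
    linear_combination (1 / 2) * C 0 1 2 * J0 + (1 / 2) * C 1 0 2 * J0 + (-1 / 2) * C 2 0 1 * J0
      + C 1 1 2 * J1 + C 2 1 2 * J2
  · simp only [Fin.mk_one, h1, h2, h3, h4, h5, h6]
    linear_combination (-1) * C 0 0 2 * J0 + (-1 / 2) * C 0 1 2 * J1 + (-1 / 2) * C 1 0 2 * J1
      + (-1 / 2) * C 2 0 1 * J1 + (-1) * C 2 0 2 * J2
  · simp only [Fin.reduceFinMk, h1, h2, h3, h4, h5, h6]
    linear_combination C 0 0 1 * J0 + C 1 0 1 * J1 + (-1 / 2) * C 0 1 2 * J2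
      + (1 / 2) * C 1 0 2 * J2 + (1 / 2) * C 2 0 1 * J2

theorem odiv_add (A B : Mat3) (j : Fin 3) : odiv C (A + B) j = odiv C A j + odiv C B j := by
  simp only [odiv, ocov, Matrix.add_apply, Fin.sum_univ_three]
  ring

theorem odiv_sub (A B : Mat3) (j : Fin 3) : odiv C (A - B) j = odiv C A j - odiv C B j := by
  simp only [odiv, ocov, Matrix.sub_apply, Fin.sum_univ_three]
  ring

theorem odiv_smul (a : ℝ) (A : Mat3) (j : Fin 3) : odiv C (a • A) j = a * odiv C A j := by
  simp only [odiv, ocov, Matrix.smul_apply, smul_eq_mul, Fin.sum_univ_three]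
  ring

theorem odiv_one (hC : IsLieTensor C) (j : Fin 3) : odiv C 1 j = 0 := by
  obtain ⟨h1, h2, h3, h4, h5, h6⟩ := hC.reduce
  simp only [odiv, ocov, conn, Fin.sum_univ_three, Matrix.one_apply]
  fin_cases j <;> simp [h1, h2, h3, h4, h5, h6] <;> ring

/-- The Leibniz rule for `∇_i (k_{in} k_{nj})`. Twice this expression is what `IsOrthonormalAt.divK`
produces, so it cancels the term `-2 k k` of the evolution equation. -/
theorem odiv_mul_self (hC : IsLieTensor C) {k : Mat3} (hk : k.IsSymm) (j : Fin 3) :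
    odiv C (k * k) j = (∑ n, odiv C k n * k n j) + ∑ i, ∑ l, k i l * ocov C k l i j := by
  obtain ⟨h1, h2, h3, h4, h5, h6⟩ := hC.reduce
  obtain ⟨k1, k2, k3⟩ := isSymm_reduce hk
  simp only [odiv, ocov, conn, Fin.sum_univ_three, Matrix.mul_apply]
  fin_cases j <;>
    simp only [Fin.zero_eta, Fin.mk_one, Fin.reduceFinMk, h1, h2, h3, h4, h5, h6, k1, k2, k3] <;>
    ring

/-- The Leibniz rule `∇_i (u^i u^j) = (div u) u^j + (∇_u u)^j`. -/
theorem odiv_vecMulVec (hC : IsLieTensor C) (u : Fin 3 → ℝ) (j : Fin 3) :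
    odiv C (Matrix.vecMulVec u u) j
      = (∑ i, trC C i * u i) * u j + ∑ a, ∑ b, conn C j a b * u a * u b := by
  obtain ⟨h1, h2, h3, h4, h5, h6⟩ := hC.reduce
  simp only [odiv, ocov, conn, trC, Fin.sum_univ_three, Matrix.vecMulVec_apply]
  fin_cases j <;>
    simp only [Fin.zero_eta, Fin.mk_one, Fin.reduceFinMk, h1, h2, h3, h4, h5, h6] <;>
    ring

/-- `⟨∇_u u, u⟩ = 0`, since the connection is metric and `u` has constant length on the group. -/
theorem conn_cubic (hC : IsLieTensor C) (u : Fin 3 → ℝ) :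
    ∑ i, ∑ j, ∑ k, conn C i j k * u i * u j * u k = 0 := by
  obtain ⟨h1, h2, h3, h4, h5, h6⟩ := hC.reduce
  simp only [conn, Fin.sum_univ_three, h1, h2, h3, h4, h5, h6]
  ring

theorem antisymm_reduce {F : Mat3} (hF : Fᵀ = -F) :
    F 0 0 = 0 ∧ F 1 1 = 0 ∧ F 2 2 = 0 ∧ F 1 0 = -F 0 1 ∧ F 2 0 = -F 0 2 ∧ F 2 1 = -F 1 2 := by
  have h (i j : Fin 3) : F j i = -F i j := congrFun (congrFun hF i) j
  exact ⟨by linarith [h 0 0], by linarith [h 1 1], by linarith [h 2 2], h 0 1, h 0 2, h 1 2⟩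

/-- The divergence of the Maxwell stresses and the rate of change of the Poynting vector, for
sourceless fields that do not satisfy the Maxwell constraints. -/
theorem odiv_maxwell (hC : IsLieTensor C) (E : Fin 3 → ℝ) {F : Mat3} (hF : Fᵀ = -F)
    (hM : magnetic C F 0 1 2 = 0) (j : Fin 3) :
    odiv C (F * Fᵀ - Matrix.vecMulVec E E) j
      = -(∑ k, (-(∑ l, trC C l * F l k) - (1 / 2) * ∑ l, ∑ n, C k l n * F l n) * F j k)
        - (∑ k, ∑ l, E k * (C l j k * E l)) - E j * ∑ k, trC C k * E k := by
  obtain ⟨h1, h2, h3, h4, h5, h6⟩ := hC.reduce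
  obtain ⟨f1, f2, f3, f4, f5, f6⟩ := antisymm_reduce hF
  simp only [magnetic, Fin.sum_univ_three, h5, f1, f2, f3, f4, f5, f6] at hM
  simp only [odiv, ocov, conn, trC, Fin.sum_univ_three, Matrix.vecMulVec_apply, Matrix.sub_apply,
    Matrix.mul_apply, Matrix.transpose_apply]
  fin_cases j
  -- In each component the two sides differ by the magnetic defect times the entry of `F` dual to
  -- `e_j`. The electric defect is kept, as the last term of the statement.
  · simp only [Fin.zero_eta, h1, h2, h3, h4, h5, h6, f1, f2, f3, f4, f5, f6]
    linear_combination (-F 1 2) * hM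
  · simp only [Fin.mk_one, h1, h2, h3, h4, h5, h6, f1, f2, f3, f4, f5, f6]
    linear_combination F 0 2 * hM
  · simp only [Fin.reduceFinMk, h1, h2, h3, h4, h5, h6, f1, f2, f3, f4, f5, f6]
    linear_combination (-F 0 1) * hM

end

/-! ### Matter and field equations in an orthonormal frame. -/

/-- A solution that is observed, at the time `t`, in an orthonormal frame. -/
structure IsOrthonormalSolution (C : Tensor12) (m Λ : ℝ) (s : ℝ → State) (I : Set ℝ) (t : ℝ) :
    Prop where
  lie : IsLieTensor C
  mem : t ∈ I
  adm : ∀ r ∈ I, (s r).Admissible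
  g_eq : (s t).g = 1
  sol : IsSolutionAt C m Λ s I t

namespace IsOrthonormalSolution

variable {C : Tensor12} {m Λ : ℝ} {s : ℝ → State} {I : Set ℝ} {t : ℝ}

theorem isOrthonormalAt (h : IsOrthonormalSolution C m Λ s I t) : IsOrthonormalAt s I t where
  mem := h.mem
  det_ne r hr := (h.adm r hr).g_posDef.det_pos.ne'
  g_eq := h.g_eq
  k_symm := h.sol.admissible.k_symm
  eq_g := h.sol.eq_g

theorem uLow_apply (h : IsOrthonormalSolution C m Λ s I t) (i : Fin 3) :
    (s t).uLow i = (s t).u i := by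
  rw [State.uLow_eq, h.g_eq, Matrix.one_mulVec]

theorem H_apply (h : IsOrthonormalSolution C m Λ s I t) : (s t).H = ∑ i, (s t).k i i := by
  simp [State.H, ginv_of_g_eq_one h.g_eq, Matrix.one_apply]

theorem dotProduct_self_nonneg (u : Fin 3 → ℝ) : 0 ≤ u ⬝ᵥ u :=
  Finset.sum_nonneg fun i _ => mul_self_nonneg (u i)

theorem u0_pos (h : IsOrthonormalSolution C m Λ s I t) : 0 < (s t).u0 := by
  rw [State.u0_eq, h.g_eq, Matrix.one_mulVec]
  refine Real.sqrt_pos.mpr ?_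
  linarith [dotProduct_self_nonneg (s t).u]

theorem rhsU_apply (h : IsOrthonormalSolution C m Λ s I t) (i : Fin 3) :
    (s t).rhsU C i = 2 * (∑ j, (s t).k i j * (s t).u j)
      - (∑ j, ∑ k, conn C i j k * (s t).u j * (s t).u k) / (s t).u0
      - 4 * Real.pi * ((s t).e / (s t).ρ) * (s t).E i
      + 4 * Real.pi * ((s t).e / (s t).ρ) * ((∑ j, (s t).F j i * (s t).u j) / (s t).u0) := by
  simp [State.rhsU, State.kMixed, ginv_of_g_eq_one h.g_eq, gam_of_g_eq_one h.g_eq,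
    Matrix.one_apply, Finset.sum_div]

theorem rhsE_apply (h : IsOrthonormalSolution C m Λ s I t) (i : Fin 3) :
    (s t).rhsE C i = (s t).H * (s t).E i + 4 * Real.pi * (s t).e * (s t).u i
      + (-(∑ l, trC C l * (s t).F l i) - (1 / 2) * ∑ l, ∑ n, C i l n * (s t).F l n) := by
  rw [State.rhsE_eq, ginv_of_g_eq_one h.g_eq]
  simp only [Matrix.transpose_one, Matrix.one_mulVec, Matrix.one_mul, Matrix.mul_one,
    Pi.add_apply, Pi.sub_apply, Pi.smul_apply, smul_eq_mul, conVec_apply, mixVec_one, swap, trC,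
    Matrix.mulVec, dotProduct, Matrix.transpose_apply, Fin.sum_univ_three]
  ring

theorem rhsF_apply (h : IsOrthonormalSolution C m Λ s I t) (i j : Fin 3) :
    (s t).rhsF C i j = ∑ k, C k i j * (s t).E k := by
  simp [State.rhsF, h.g_eq, Matrix.one_apply]

/-- The trace part of the right-hand side of the evolution equation of `k`. -/
def traceSource (m Λ : ℝ) (s : State) : ℝ :=
  -8 * Real.pi * ((1 / 2) * (s.dotPhi ^ 2 - m ^ 2 * s.Φ ^ 2) + (1 / 2) * ∑ i, s.E i ^ 2
      - (1 / 4) * ∑ i, ∑ j, s.F i j ^ 2)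
    + 4 * Real.pi * (-s.T00 m - s.ρ * s.u0 ^ 2 + (3 / 2) * (s.dotPhi ^ 2 - m ^ 2 * s.Φ ^ 2)
      + s.ρ * ∑ i, s.u i ^ 2) - Λ

/-- All terms proportional to the metric are gathered in `traceSource`; they are divergence-free by
`odiv_one`, so their exact form is irrelevant for the momentum constraints. -/
theorem rhsK_eq (h : IsOrthonormalSolution C m Λ s I t) :
    Matrix.of ((s t).rhsK C m Λ) = Matrix.of (oric C) + (s t).H • (s t).k
      - (2 : ℝ) • ((s t).k * (s t).k)
      - (8 * Real.pi) • ((s t).F * (s t).Fᵀ - Matrix.vecMulVec (s t).E (s t).E)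
      - (8 * Real.pi * (s t).ρ) • Matrix.vecMulVec (s t).u (s t).u
      + traceSource m Λ (s t) • 1 := by
  have hric : Matrix.of ((s t).ric C) = Matrix.of (oric C) := by
    ext i j
    exact ric_of_g_eq_one h.g_eq C i j
  rw [State.rhsK_eq, State.T_eq, State.tau_eq, hric, ginv_of_g_eq_one h.g_eq, h.g_eq,
    State.normE_eq, State.normF_eq, ginv_of_g_eq_one h.g_eq, h.g_eq]
  simp only [Matrix.one_mulVec, Matrix.one_mul, Matrix.mul_one, Matrix.transpose_one,
    Matrix.transpose_smul]
  ext i j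
  simp only [Matrix.add_apply, Matrix.sub_apply, Matrix.smul_apply, smul_eq_mul,
    Matrix.one_apply_eq, traceSource, State.u0Low, dotProduct, Matrix.trace,
    Matrix.diag, Matrix.mul_apply, Matrix.transpose_apply, Fin.sum_univ_three, Matrix.of_apply]
  ring

theorem u_dot_rhsU (h : IsOrthonormalSolution C m Λ s I t) :
    ∑ i, (s t).u i * (s t).rhsU C i = 2 * (∑ i, ∑ j, (s t).k i j * (s t).u i * (s t).u j)
      - 4 * Real.pi * ((s t).e / (s t).ρ) * ∑ i, (s t).E i * (s t).u i := by
  obtain ⟨f1, f2, f3, f4, f5, f6⟩ := antisymm_reduce h.sol.admissible.F_antisymm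
  have hc := conn_cubic h.lie (s t).u
  simp only [rhsU_apply h]
  simp only [Fin.sum_univ_three, f1, f2, f3, f4, f5, f6] at hc ⊢
  -- The geodesic term does no work by `conn_cubic`, the magnetic force none by antisymmetry of `F`.
  linear_combination (-1 / (s t).u0) * hc

theorem hasDerivWithinAt_u0 (h : IsOrthonormalSolution C m Λ s I t) :
    HasDerivWithinAt (fun r => (s r).u0)
      (((∑ i, ∑ j, (s t).k i j * (s t).u i * (s t).u j)
        - 4 * Real.pi * ((s t).e / (s t).ρ) * ∑ i, (s t).E i * (s t).u i) / (s t).u0) I t := by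
  have h1 := (HasDerivWithinAt.fun_sum (u := Finset.univ) fun i _ =>
    HasDerivWithinAt.fun_sum (u := Finset.univ) fun j _ =>
      ((h.sol.eq_g i j).fun_mul (h.sol.eq_u i)).fun_mul (h.sol.eq_u j)).const_add 1
  have hpos : 1 + ∑ i, ∑ j, (s t).g i j * (s t).u i * (s t).u j ≠ 0 := by
    have := h.u0_pos
    rw [State.u0, Real.sqrt_pos] at this
    exact this.ne'
  refine (h1.sqrt hpos).congr_deriv ?_
  have hu := h.u_dot_rhsU
  have hv : √(1 + ∑ i, ∑ j, (s t).g i j * (s t).u i * (s t).u j) = (s t).u0 := rfl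
  rw [hv, ← div_div]
  congr 1
  simp only [State.rhsG, h.g_eq, Matrix.one_apply]
  simp only [Fin.sum_univ_three] at hu ⊢
  simp
  linear_combination hu

theorem expansion_apply (h : IsOrthonormalSolution C m Λ s I t) :
    (s t).expansion C = (∑ i, ∑ j, (s t).k i j * (s t).u i * (s t).u j) / (s t).u0 ^ 2
      + (∑ i, trC C i * (s t).u i) / (s t).u0 - (s t).H := by
  rw [State.expansion_eq, ginv_of_g_eq_one h.g_eq, h.H_apply]
  simp only [Matrix.one_mul, Matrix.trace, Matrix.diag, mixVec_one, swap, dotProduct,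
    Matrix.mulVec, trC, Fin.sum_univ_three]
  ring

theorem work_apply (h : IsOrthonormalSolution C m Λ s I t) :
    (s t).work = (∑ i, (s t).E i * (s t).u i) / (s t).u0 ^ 2 := by
  rw [State.work_eq, h.g_eq, Matrix.one_mulVec, dotProduct_comm]
  rfl

/-- Conservation of mass. -/
theorem hasDerivWithinAt_rho_u0 (h : IsOrthonormalSolution C m Λ s I t) :
    HasDerivWithinAt (fun r => (s r).ρ * (s r).u0)
      ((s t).H * (s t).ρ * (s t).u0 - (s t).ρ * ∑ i, trC C i * (s t).u i) I t := by
  refine (h.sol.eq_rho.fun_mul h.hasDerivWithinAt_u0).congr_deriv ?_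
  rw [h.expansion_apply, h.work_apply]
  have h1 := h.u0_pos.ne'
  have h2 := h.sol.admissible.rho_pos.ne'
  field_simp
  ring

/-- Conservation of charge. -/
theorem hasDerivWithinAt_e_u0 (h : IsOrthonormalSolution C m Λ s I t) :
    HasDerivWithinAt (fun r => (s r).e * (s r).u0)
      ((s t).H * (s t).e * (s t).u0 - (s t).e * ∑ i, trC C i * (s t).u i) I t := by
  refine (h.sol.eq_e.fun_mul h.hasDerivWithinAt_u0).congr_deriv ?_
  rw [h.expansion_apply, h.work_apply]
  have h1 := h.u0_pos.ne'
  have h2 := h.sol.admissible.rho_pos.ne'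
  field_simp
  ring

end IsOrthonormalSolution

/-! ### The constraint defects and their evolution. -/

namespace State

variable (C : Tensor12) (m Λ : ℝ) (s : State)

/-- The defect of the electric constraint. -/
def electricDefect : ℝ := (∑ i, ∑ k, C i i k * s.E k) + 4 * Real.pi * s.e * s.u0

/-- The defect of the momentum constraints. -/
def momentumDefect (j : Fin 3) : ℝ :=
  s.divK C j - -8 * Real.pi * (s.T0 j + s.tau0 j + s.ρ * s.u0Low * s.uLow j)

/-- The defect of the Hamiltonian constraint. -/
def hamiltonianDefect : ℝ :=
  s.scal C - (∑ i, ∑ j, s.k i j * s.kUp i j) + s.H ^ 2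
    - (16 * Real.pi * (s.T00 m + s.tau00 + s.ρ * s.u0Low ^ 2) + 2 * Λ)

end State

/-- `tr ad` vanishes on brackets, because a commutator of matrices is traceless. -/
theorem IsLieTensor.trC_mul {C : Tensor12} (hC : IsLieTensor C) (i j : Fin 3) :
    ∑ l, trC C l * C l i j = 0 := by
  have h := congrArg Matrix.trace (hC.jacobi i j)
  rw [Matrix.trace_sub, Matrix.trace_mul_comm, sub_self, Matrix.trace_sum] at h
  have htr (l : Fin 3) : (C.slice l).trace = -trC C l := by
    simp only [trC, Matrix.trace, Matrix.diag, slice, Matrix.of_apply, ← Finset.sum_neg_distrib]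
    exact Finset.sum_congr rfl fun i _ => hC.antisymm i l i
  simp only [Matrix.trace_smul, htr, smul_eq_mul, Fin.sum_univ_three] at h ⊢
  linarith

namespace IsOrthonormalSolution

variable {C : Tensor12} {m Λ : ℝ} {s : ℝ → State} {I : Set ℝ} {t : ℝ}

/-- Contracting `E'` with `trC` kills the magnetic terms: one by `trC_mul`, the other by
antisymmetry of `F`. The current cancels against charge conservation. -/
theorem hasDerivWithinAt_electricDefect (h : IsOrthonormalSolution C m Λ s I t) :
    HasDerivWithinAt (fun r => (s r).electricDefect C)
      ((s t).H * (s t).electricDefect C) I t := by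
  have h1 := (HasDerivWithinAt.fun_sum (u := Finset.univ) fun i _ =>
    HasDerivWithinAt.fun_sum (u := Finset.univ) fun k _ =>
      (h.sol.eq_E k).const_mul (C i i k)).add
    (h.hasDerivWithinAt_e_u0.const_mul (4 * Real.pi))
  have h2 : (fun r => (s r).electricDefect C) = (fun r => ∑ i, ∑ k, C i i k * (s r).E k)
      + fun r => 4 * Real.pi * ((s r).e * (s r).u0) := by
    funext r
    simp [State.electricDefect, mul_assoc]
  rw [h2]
  refine h1.congr_deriv ?_
  have hJ (i j : Fin 3) := h.lie.trC_mul i j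
  obtain ⟨f1, f2, f3, f4, f5, f6⟩ := antisymm_reduce h.sol.admissible.F_antisymm
  have J1 := hJ 0 1
  have J2 := hJ 0 2
  have J3 := hJ 1 2
  obtain ⟨c1, c2, c3, c4, c5, c6⟩ := h.lie.reduce
  simp only [h.rhsE_apply, State.electricDefect]
  simp only [trC, Fin.sum_univ_three, f1, f2, f3, f4, f5, f6, c1, c2, c3, c4, c5, c6] at J1 J2 J3 ⊢
  linear_combination (-(s t).F 0 1) * J1 - (s t).F 0 2 * J2 - (s t).F 1 2 * J3

/-- Lowering the index absorbs the term `2 k u` of `u'` into `g' = -2k`. -/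
theorem hasDerivWithinAt_uLow (h : IsOrthonormalSolution C m Λ s I t) (j : Fin 3) :
    HasDerivWithinAt (fun r => (s r).uLow j)
      (-(∑ a, ∑ b, conn C j a b * (s t).u a * (s t).u b) / (s t).u0
        - 4 * Real.pi * ((s t).e / (s t).ρ) * (s t).E j
        + 4 * Real.pi * ((s t).e / (s t).ρ) * ((∑ i, (s t).F i j * (s t).u i) / (s t).u0)) I t := by
  have h1 := HasDerivWithinAt.fun_sum (u := Finset.univ) fun i _ =>
    (h.sol.eq_g j i).fun_mul (h.sol.eq_u i)
  refine h1.congr_deriv ?_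
  simp only [State.rhsG, h.g_eq, Matrix.one_apply, ite_mul, one_mul, zero_mul,
    Finset.sum_add_distrib, Finset.sum_ite_eq, Finset.mem_univ, if_true, h.rhsU_apply]
  simp only [Fin.sum_univ_three]
  ring

/-- The balance of the momentum of the matter. -/
theorem hasDerivWithinAt_momentum (h : IsOrthonormalSolution C m Λ s I t) (j : Fin 3) :
    HasDerivWithinAt (fun r => (s r).ρ * (s r).u0 * (s r).uLow j)
      ((s t).H * (s t).ρ * (s t).u0 * (s t).u j
        - (s t).ρ * odiv C (Matrix.vecMulVec (s t).u (s t).u) j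
        - 4 * Real.pi * (s t).e * (s t).u0 * (s t).E j
        + 4 * Real.pi * (s t).e * ∑ i, (s t).F i j * (s t).u i) I t := by
  refine (h.hasDerivWithinAt_rho_u0.fun_mul (h.hasDerivWithinAt_uLow j)).congr_deriv ?_
  rw [odiv_vecMulVec h.lie, h.uLow_apply]
  have h1 := h.u0_pos.ne'
  have h2 := h.sol.admissible.rho_pos.ne'
  field_simp
  ring

theorem hasDerivWithinAt_tau0 (h : IsOrthonormalSolution C m Λ s I t) (j : Fin 3) :
    HasDerivWithinAt (fun r => (s r).tau0 j)
      (-∑ k, ((s t).rhsE C k * (s t).F j k + (s t).E k * (s t).rhsF C j k)) I t :=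
  (HasDerivWithinAt.fun_sum (u := Finset.univ) fun k _ =>
    (h.sol.eq_E k).fun_mul (h.sol.eq_F j k)).neg

theorem hasDerivWithinAt_momentumDefect (h : IsOrthonormalSolution C m Λ s I t)
    (hel : (s t).electricDefect C = 0) (hmag : magnetic C (s t).F 0 1 2 = 0) (j : Fin 3) :
    HasDerivWithinAt (fun r => (s r).momentumDefect C j)
      ((s t).H * (s t).momentumDefect C j) I t := by
  have h1 := (h.isOrthonormalAt.divK h.lie (Z := Matrix.of ((s t).rhsK C m Λ)) h.sol.eq_k j).add
    (((h.hasDerivWithinAt_tau0 j).sub (h.hasDerivWithinAt_momentum j)).const_mul (8 * Real.pi))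
  have h2 : (fun r => (s r).momentumDefect C j) = (fun r => (s r).divK C j)
      + fun r => 8 * Real.pi * ((s r).tau0 j - (s r).ρ * (s r).u0 * (s r).uLow j) := by
    funext r
    simp only [State.momentumDefect, State.T0, State.u0Low, Pi.add_apply]
    ring
  rw [h2]
  refine h1.congr_deriv ?_
  have hk := odiv_mul_self h.lie h.sol.admissible.k_symm j
  have hem := odiv_maxwell h.lie (s t).E h.sol.admissible.F_antisymm hmag j
  rw [State.electricDefect] at hel
  rw [h.rhsK_eq]
  simp only [odiv_add, odiv_sub, odiv_smul, odiv_oric h.lie, odiv_one h.lie] at hem ⊢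
  simp only [h.rhsE_apply, h.rhsF_apply, State.momentumDefect, divK_of_g_eq_one h.g_eq, State.T0,
    State.u0Low, h.uLow_apply, State.tau0]
  have hF : ∑ i, (s t).F i j * (s t).u i = -∑ i, (s t).F j i * (s t).u i := by
    rw [← Finset.sum_neg_distrib]
    refine Finset.sum_congr rfl fun i _ => ?_
    have : (s t).F i j = -(s t).F j i :=
      congrFun (congrFun h.sol.admissible.F_antisymm j) i
    rw [this, neg_mul]
  simp only [trC, Fin.sum_univ_three] at hk hem hel hF ⊢
  -- The divergence of the Maxwell stresses balances the rate of the Poynting vector, and the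
  -- current terms balance the Lorentz force, up to `E_j` times the electric defect. The factor `32
  -- π²` is `8 π` from the constraint times `4 π` from the Lorentz force.
  linear_combination (-2) * hk - 8 * Real.pi * hem + 8 * Real.pi * (s t).E j * hel
    - 32 * Real.pi ^ 2 * (s t).e * hF

theorem hasDerivWithinAt_H (h : IsOrthonormalSolution C m Λ s I t) :
    HasDerivWithinAt (fun r => (s r).H)
      (2 * (∑ i, ∑ j, (s t).k i j ^ 2) + ∑ i, (s t).rhsK C m Λ i i) I t := by
  have h1 := HasDerivWithinAt.fun_sum (u := Finset.univ) fun i _ =>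
    HasDerivWithinAt.fun_sum (u := Finset.univ) fun j _ =>
      (h.isOrthonormalAt.ginv i j).fun_mul (h.sol.eq_k i j)
  refine h1.congr_deriv ?_
  simp only [ginv_of_g_eq_one h.g_eq, Matrix.one_apply, ite_mul, one_mul, zero_mul,
    Finset.sum_add_distrib, Finset.sum_ite_eq, Finset.mem_univ, if_true, Finset.mul_sum, sq,
    mul_assoc]

theorem hasDerivWithinAt_kUp (h : IsOrthonormalSolution C m Λ s I t) (i j : Fin 3) :
    HasDerivWithinAt (fun r => (s r).kUp i j)
      (4 * ((s t).k * (s t).k) i j + (s t).rhsK C m Λ i j) I t := by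
  have h1 := HasDerivWithinAt.fun_sum (u := Finset.univ) fun l _ =>
    HasDerivWithinAt.fun_sum (u := Finset.univ) fun n _ =>
      ((h.isOrthonormalAt.ginv i l).fun_mul (h.isOrthonormalAt.ginv j n)).fun_mul (h.sol.eq_k l n)
  refine h1.congr_deriv ?_
  obtain ⟨k1, k2, k3⟩ := isSymm_reduce h.sol.admissible.k_symm
  simp only [ginv_of_g_eq_one h.g_eq, Matrix.one_apply, Matrix.mul_apply, Fin.sum_univ_three]
  fin_cases i <;> fin_cases j <;> simp [k1, k2, k3] <;> ring

theorem kUp_apply (h : IsOrthonormalSolution C m Λ s I t) (i j : Fin 3) :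
    (s t).kUp i j = (s t).k i j := by
  rw [State.kUp_eq, ginv_of_g_eq_one h.g_eq]
  simp

/-- Written with `U`, the energy is differentiable even where `U = 0`, a point at which the square
root in `dotPhi` is not. This form is valid because `0 ≤ U`. -/
theorem T00_of_admissible {s : State} (hs : s.Admissible) (m : ℝ) :
    s.T00 m = s.U + 1 / 2 * m ^ 2 * s.Φ ^ 2 := by
  have := hs.U_nonneg
  rw [State.T00, State.dotPhi, Real.sq_sqrt (by positivity)]
  ring

theorem hasDerivWithinAt_T00 (h : IsOrthonormalSolution C m Λ s I t) :
    HasDerivWithinAt (fun r => (s r).T00 m) ((s t).H * (s t).dotPhi ^ 2) I t := by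
  have h1 := h.sol.eq_U.add ((h.sol.eq_Phi.fun_pow 2).const_mul (1 / 2 * m ^ 2))
  refine (h1.congr_of_mem (fun r hr => T00_of_admissible (h.adm r hr) m) h.mem).congr_deriv ?_
  have := h.sol.admissible.U_nonneg
  rw [State.dotPhi, Real.sq_sqrt (by positivity)]
  ring

theorem hasDerivWithinAt_normE (h : IsOrthonormalSolution C m Λ s I t) :
    HasDerivWithinAt (fun r => (s r).normE)
      (-2 * (∑ i, ∑ j, (s t).k i j * (s t).E i * (s t).E j)
        + 2 * ∑ i, (s t).E i * (s t).rhsE C i) I t := by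
  have h1 := HasDerivWithinAt.fun_sum (u := Finset.univ) fun i _ =>
    HasDerivWithinAt.fun_sum (u := Finset.univ) fun j _ =>
      ((h.sol.eq_g i j).fun_mul (h.sol.eq_E i)).fun_mul (h.sol.eq_E j)
  refine h1.congr_deriv ?_
  simp only [State.rhsG, h.g_eq, Matrix.one_apply, Fin.sum_univ_three]
  simp
  ring

theorem hasDerivWithinAt_normF (h : IsOrthonormalSolution C m Λ s I t) :
    HasDerivWithinAt (fun r => (s r).normF)
      (4 * (∑ i, ∑ j, (s t).k i j * ((s t).F * (s t).Fᵀ) i j)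
        + 2 * ∑ i, ∑ j, (s t).F i j * (s t).rhsF C i j) I t := by
  have h1 := HasDerivWithinAt.fun_sum (u := Finset.univ) fun i _ =>
    HasDerivWithinAt.fun_sum (u := Finset.univ) fun j _ =>
      HasDerivWithinAt.fun_sum (u := Finset.univ) fun k _ =>
        HasDerivWithinAt.fun_sum (u := Finset.univ) fun l _ =>
          (((h.isOrthonormalAt.ginv i k).fun_mul (h.isOrthonormalAt.ginv j l)).fun_mul
            (h.sol.eq_F i j)).fun_mul (h.sol.eq_F k l)
  refine h1.congr_deriv ?_
  obtain ⟨k1, k2, k3⟩ := isSymm_reduce h.sol.admissible.k_symm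
  obtain ⟨f1, f2, f3, f4, f5, f6⟩ := antisymm_reduce h.sol.admissible.F_antisymm
  simp only [ginv_of_g_eq_one h.g_eq, Matrix.one_apply, Matrix.mul_apply, Matrix.transpose_apply,
    Fin.sum_univ_three, k1, k2, k3, f1, f2, f3, f4, f5, f6]
  simp
  ring

/-- The rate of change of the energy of the matter. -/
theorem hasDerivWithinAt_energy (h : IsOrthonormalSolution C m Λ s I t) :
    HasDerivWithinAt (fun r => (s r).ρ * (s r).u0 * (s r).u0)
      ((s t).H * (s t).ρ * (s t).u0 ^ 2 - (s t).ρ * (s t).u0 * (∑ i, trC C i * (s t).u i)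
        + (s t).ρ * (∑ i, ∑ j, (s t).k i j * (s t).u i * (s t).u j)
        - 4 * Real.pi * (s t).e * ∑ i, (s t).E i * (s t).u i) I t := by
  refine (h.hasDerivWithinAt_rho_u0.fun_mul h.hasDerivWithinAt_u0).congr_deriv ?_
  have h1 := h.u0_pos.ne'
  have h2 := h.sol.admissible.rho_pos.ne'
  field_simp
  ring

theorem tau00_apply (h : IsOrthonormalSolution C m Λ s I t) :
    (s t).tau00 = 1 / 2 * (∑ i, (s t).E i ^ 2) + 1 / 4 * ∑ i, ∑ j, (s t).F i j ^ 2 := by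
  rw [State.tau00, State.normE_eq, State.normF_eq, ginv_of_g_eq_one h.g_eq, h.g_eq]
  simp [Matrix.trace, Matrix.mul_apply, dotProduct, sq]

/-- No constraint is assumed here. The curl terms of `E'` and `F'` cancel in the electromagnetic
energy; what survives from curvature, Poynting vector and matter flux is the divergence of the
momentum defect. -/
theorem hasDerivWithinAt_hamiltonianDefect (h : IsOrthonormalSolution C m Λ s I t) :
    HasDerivWithinAt (fun r => (s r).hamiltonianDefect C m Λ)
      (2 * (s t).H * (s t).hamiltonianDefect C m Λ
        - 2 * ∑ j, trC C j * (s t).momentumDefect C j) I t := by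
  have h1 := (((h.isOrthonormalAt.scal h.lie).sub
    (HasDerivWithinAt.fun_sum (u := Finset.univ) fun i _ =>
      HasDerivWithinAt.fun_sum (u := Finset.univ) fun j _ =>
        (h.sol.eq_k i j).fun_mul (h.hasDerivWithinAt_kUp i j))).add
    (h.hasDerivWithinAt_H.fun_pow 2)).sub
    ((((h.hasDerivWithinAt_T00.add ((h.hasDerivWithinAt_normE.const_mul (1 / 2)).add
      (h.hasDerivWithinAt_normF.const_mul (1 / 4)))).add h.hasDerivWithinAt_energy).const_mul
        (16 * Real.pi)).add_const (2 * Λ))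
  have h2 : (fun r => (s r).hamiltonianDefect C m Λ)
      = ((fun r => (s r).scal C) - (fun r => ∑ i, ∑ j, (s r).k i j * (s r).kUp i j)
        + fun r => (s r).H ^ 2)
        - fun r => 16 * Real.pi * ((s r).T00 m + (1 / 2 * (s r).normE + 1 / 4 * (s r).normF)
          + (s r).ρ * (s r).u0 * (s r).u0) + 2 * Λ := by
    funext r
    simp only [State.hamiltonianDefect, State.tau00, State.u0Low, Pi.sub_apply, Pi.add_apply]
    ring
  rw [h2]
  refine h1.congr_deriv ?_
  have hZ (i j : Fin 3) : (s t).rhsK C m Λ i j = _ := congrFun (congrFun h.rhsK_eq i) j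
  have hscal : (s t).scal C = ∑ i, oric C i i := by
    simp [State.scal, ginv_of_g_eq_one h.g_eq, ric_of_g_eq_one h.g_eq, Matrix.one_apply]
  have hH := h.H_apply
  simp only [hZ, h.rhsE_apply, h.rhsF_apply, State.hamiltonianDefect, State.momentumDefect,
    divK_of_g_eq_one h.g_eq, State.T0, State.u0Low, h.uLow_apply, State.tau0, h.kUp_apply,
    h.tau00_apply, hscal, State.T00, traceSource, Matrix.add_apply, Matrix.sub_apply,
    Matrix.smul_apply, smul_eq_mul, Matrix.of_apply, Matrix.vecMulVec_apply, Matrix.one_apply]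
  obtain ⟨k1, k2, k3⟩ := isSymm_reduce h.sol.admissible.k_symm
  obtain ⟨f1, f2, f3, f4, f5, f6⟩ := antisymm_reduce h.sol.admissible.F_antisymm
  simp only [Fin.sum_univ_three, Matrix.mul_apply, Matrix.transpose_apply] at hH ⊢
  simp only [hH, k1, k2, k3, f1, f2, f3, f4, f5, f6]
  simp
  ring

end IsOrthonormalSolution

/-- The form of the Jacobi identity that matches the cyclic sum in `magnetic`. -/
theorem IsLieTensor.jacobi_cyclic {C : Tensor12} (hC : IsLieTensor C) (a i j k : Fin 3) :
    (∑ l, C l i j * C a k l) + (∑ l, C l k i * C a j l) + (∑ l, C l j k * C a i l) = 0 := by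
  have h := congrFun (congrFun (hC.jacobi i j) a) k
  simp only [slice, Matrix.sub_apply, Matrix.mul_apply, Matrix.sum_apply, Matrix.smul_apply,
    Matrix.of_apply, smul_eq_mul] at h
  rw [← Finset.sum_sub_distrib] at h
  rw [← Finset.sum_add_distrib, ← Finset.sum_add_distrib, ← sub_eq_zero.mpr h,
    ← Finset.sum_sub_distrib]
  refine Finset.sum_congr rfl fun l _ => ?_
  rw [hC.antisymm a k l, hC.antisymm l k i]
  ring

/-! ### Covariance of the defects. -/

namespace State

variable (C : Tensor12) (m Λ : ℝ) (s : State) {P Q : Mat3}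

theorem electricDefect_pull (hPQ : P * Q = 1) (hQP : Q * P = 1) :
    (s.pull P Q).electricDefect (C.pull P Q) = s.electricDefect C := by
  have h (C : Tensor12) (E : Fin 3 → ℝ) :
      ∑ i, ∑ k, C i i k * E k = E ⬝ᵥ mixVec 1 (swap C) := by
    simp only [dotProduct, mixVec_one, swap, Fin.sum_univ_three]
    ring
  rw [electricDefect, electricDefect, h, h, swap_pull, mixVec_one_pull hPQ hQP, u0_pull s hPQ,
    pull_e, pull_E, mulVec_dotProduct_cancel hPQ]

theorem momentumDefect_eq : s.momentumDefect C
    = s.divK C + (8 * Real.pi) • (s.tau0 + (s.ρ * s.u0Low) • s.uLow) := by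
  funext j
  simp only [momentumDefect, T0, Pi.add_apply, Pi.smul_apply, smul_eq_mul]
  ring

theorem momentumDefect_pull (hPQ : P * Q = 1) :
    (s.pull P Q).momentumDefect (C.pull P Q) = Pᵀ *ᵥ s.momentumDefect C := by
  rw [momentumDefect_eq, momentumDefect_eq, divK_pull C s hPQ, tau0_pull s hPQ, uLow_pull s hPQ,
    u0Low_pull s hPQ, pull_ρ]
  simp only [Matrix.mulVec_add, Matrix.mulVec_smul]

theorem hamiltonianDefect_pull (hPQ : P * Q = 1) (hQP : Q * P = 1) :
    (s.pull P Q).hamiltonianDefect (C.pull P Q) m Λ = s.hamiltonianDefect C m Λ := by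
  have h (s : State) : ∑ i, ∑ j, s.k i j * s.kUp i j
      = ((s.ginv * s.k * s.ginvᵀ) * s.kᵀ).trace := by
    simp [kUp_eq, Matrix.trace, Matrix.mul_apply, mul_comm]
  rw [hamiltonianDefect, hamiltonianDefect, h, h, scal_pull C s hPQ hQP, H_pull s hPQ,
    T00_pull, tau00_pull s hPQ, u0Low_pull s hPQ, ginv_pull s hPQ, pull_k, pull_ρ, transpose_low,
    transpose_up, conj_mul_low hPQ, conj_mul_up hPQ, conj_mul_low hPQ, trace_conj hPQ]

theorem constraints_iff : s.Constraints C m Λ ↔ s.hamiltonianDefect C m Λ = 0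
    ∧ s.momentumDefect C = 0 ∧ magnetic C s.F = 0 ∧ s.electricDefect C = 0 := by
  constructor
  · intro h
    refine ⟨sub_eq_zero.mpr h.hamiltonian, ?_, ?_, h.electric⟩
    · funext j
      exact sub_eq_zero.mpr (h.momentum j)
    · funext i j k
      exact h.magnetic i j k
  · rintro ⟨h1, h2, h3, h4⟩
    exact ⟨sub_eq_zero.mp h1, fun j => sub_eq_zero.mp (congrFun h2 j),
      fun i j k => congrFun (congrFun (congrFun h3 i) j) k, h4⟩

end State

/-! ### Propagation of the constraints. -/

namespace IsSolutionOn

variable {C : Tensor12} {m Λ : ℝ} {s : ℝ → State} {I : Set ℝ} {t : ℝ}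

/-- Up to sign, `F'` is the exterior derivative of the left invariant 1-form dual to `E`, and
`magnetic` is the exterior derivative of `F`; so this is `d² = 0`. No special frame is needed. -/
theorem hasDerivWithinAt_magnetic (h : IsSolutionOn C m Λ s I) (hC : IsLieTensor C) (ht : t ∈ I)
    (i j k : Fin 3) : HasDerivWithinAt (fun r => magnetic C (s r).F i j k) 0 I t := by
  have key (i j k : Fin 3) := HasDerivWithinAt.fun_sum (u := Finset.univ) fun l _ =>
    (h.eq_F t ht k l).const_mul (C l i j)
  refine (((key i j k).add (key k i j)).add (key j k i)).congr_deriv ?_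
  have hF (i j : Fin 3) : (s t).rhsF C i j = ∑ a, ((s t).g *ᵥ (s t).E) a * C a i j :=
    congrFun (congrFun (State.rhsF_eq C (s t)) i) j
  have hJ (a : Fin 3) := hC.jacobi_cyclic a i j k
  have h0 := hJ 0
  have h1 := hJ 1
  have h2 := hJ 2
  simp only [hF, Fin.sum_univ_three] at h0 h1 h2 ⊢
  linear_combination ((s t).g *ᵥ (s t).E) 0 * h0 + ((s t).g *ᵥ (s t).E) 1 * h1
    + ((s t).g *ᵥ (s t).E) 2 * h2

theorem continuousOn_H (h : IsSolutionOn C m Λ s I) : ContinuousOn (fun r => (s r).H) I := by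
  intro t ht
  have hg (i j : Fin 3) : ContinuousWithinAt (fun r => (s r).ginv i j) I t :=
    (differentiableWithinAt_inv_apply (fun i j => (h.eq_g t ht i j).differentiableWithinAt)
      (h.admissible t ht).g_posDef.det_pos.ne' i j).continuousWithinAt
  have hk (i j : Fin 3) : ContinuousWithinAt (fun r => (s r).k i j) I t :=
    (h.eq_k t ht i j).continuousWithinAt
  simp only [State.H, Fin.sum_univ_three]
  fun_prop

/-- The frame is adapted to the time `t` but does not depend on `r`, so it commutes with time
derivatives and the transformed curve solves the same system. -/
theorem exists_isOrthonormalSolution (h : IsSolutionOn C m Λ s I) (hC : IsLieTensor C)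
    (ht : t ∈ I) : ∃ P Q : Mat3, P * Q = 1 ∧ Q * P = 1
      ∧ IsOrthonormalSolution (C.pull P Q) m Λ (fun r => (s r).pull P Q) I t := by
  obtain ⟨P, Q, hPQ, hQP, hg⟩ := exists_orthonormal_frame (h.admissible t ht).g_posDef
  exact ⟨P, Q, hPQ, hQP, hC.pull hPQ, ht, fun r hr => (h.admissible r hr).pull hPQ, hg,
    (h.isSolutionAt ht).pull hPQ hQP⟩

theorem hasDerivWithinAt_electricDefect (h : IsSolutionOn C m Λ s I) (hC : IsLieTensor C)
    (ht : t ∈ I) : HasDerivWithinAt (fun r => (s r).electricDefect C)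
      ((s t).H * (s t).electricDefect C) I t := by
  obtain ⟨P, Q, hPQ, hQP, hs⟩ := h.exists_isOrthonormalSolution hC ht
  simpa only [State.electricDefect_pull C _ hPQ hQP, State.H_pull _ hPQ]
    using hs.hasDerivWithinAt_electricDefect

theorem hasDerivWithinAt_momentumDefect (h : IsSolutionOn C m Λ s I) (hC : IsLieTensor C)
    (ht : t ∈ I) (hel : (s t).electricDefect C = 0) (hmag : magnetic C (s t).F = 0) (j : Fin 3) :
    HasDerivWithinAt (fun r => (s r).momentumDefect C j)
      ((s t).H * (s t).momentumDefect C j) I t := by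
  obtain ⟨P, Q, hPQ, hQP, hs⟩ := h.exists_isOrthonormalSolution hC ht
  have hel' : ((s t).pull P Q).electricDefect (C.pull P Q) = 0 := by
    rw [State.electricDefect_pull C _ hPQ hQP, hel]
  have hmag' : magnetic (C.pull P Q) ((s t).pull P Q).F 0 1 2 = 0 := by
    rw [State.pull_F, magnetic_pull hPQ]
    simp [hmag]
  -- The momentum defect is a covector, so `Qᵀ` returns it to the original frame; being constant, it
  -- passes through the derivative.
  have back (r : ℝ) : Qᵀ *ᵥ ((s r).pull P Q).momentumDefect (C.pull P Q)
      = (s r).momentumDefect C := by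
    rw [State.momentumDefect_pull C _ hPQ, Matrix.mulVec_mulVec, State.transpose_cancel hPQ,
      Matrix.one_mulVec]
  have hd := hasDerivWithinAt_mulVec Qᵀ
    (x' := (s t).H • ((s t).pull P Q).momentumDefect (C.pull P Q))
    (fun i => by
      simpa only [State.H_pull _ hPQ, Pi.smul_apply, smul_eq_mul] using
        hs.hasDerivWithinAt_momentumDefect hel' hmag' i) j
  simpa only [Matrix.mulVec_smul, back, Pi.smul_apply, smul_eq_mul] using hd

theorem hasDerivWithinAt_hamiltonianDefect (h : IsSolutionOn C m Λ s I) (hC : IsLieTensor C)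
    (ht : t ∈ I) (hmom : (s t).momentumDefect C = 0) :
    HasDerivWithinAt (fun r => (s r).hamiltonianDefect C m Λ)
      (2 * (s t).H * (s t).hamiltonianDefect C m Λ) I t := by
  obtain ⟨P, Q, hPQ, hQP, hs⟩ := h.exists_isOrthonormalSolution hC ht
  have := hs.hasDerivWithinAt_hamiltonianDefect
  simpa only [State.hamiltonianDefect_pull C m Λ _ hPQ hQP, State.H_pull _ hPQ,
    State.momentumDefect_pull C _ hPQ, hmom, Matrix.mulVec_zero, Pi.zero_apply, mul_zero,
    Finset.sum_const_zero, sub_zero] using this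

theorem constraints (h : IsSolutionOn C m Λ s I) (hC : IsLieTensor C) (hI : I.OrdConnected)
    {t₀ : ℝ} (h₀ : t₀ ∈ I) (hc : (s t₀).Constraints C m Λ) (ht : t ∈ I) :
    (s t).Constraints C m Λ := by
  obtain ⟨c1, c2, c3, c4⟩ := (State.constraints_iff C m Λ _).mp hc
  have hH := h.continuousOn_H
  have hmag : ∀ t ∈ I, magnetic C (s t).F = 0 := by
    intro t ht
    funext i j k
    refine eq_zero_of_hasDerivWithinAt_mul_self hI (a := fun _ => 0) continuousOn_const
      (f := fun r => magnetic C (s r).F i j k) (fun t ht => ?_) h₀ ?_ ht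
    · simpa using h.hasDerivWithinAt_magnetic hC ht i j k
    · simp [c3]
  have hel : ∀ t ∈ I, (s t).electricDefect C = 0 := fun t ht =>
    eq_zero_of_hasDerivWithinAt_mul_self hI hH
      (fun t ht => h.hasDerivWithinAt_electricDefect hC ht) h₀ c4 ht
  have hmom : ∀ t ∈ I, (s t).momentumDefect C = 0 := by
    intro t ht
    funext j
    exact eq_zero_of_hasDerivWithinAt_mul_self hI hH
      (f := fun r => (s r).momentumDefect C j)
      (fun t ht => h.hasDerivWithinAt_momentumDefect hC ht (hel t ht) (hmag t ht) j) h₀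
      (congrFun c2 j) ht
  have hham : (s t).hamiltonianDefect C m Λ = 0 :=
    eq_zero_of_hasDerivWithinAt_mul_self hI (hH.const_smul (2 : ℝ))
      (f := fun r => (s r).hamiltonianDefect C m Λ)
      (fun t ht => h.hasDerivWithinAt_hamiltonianDefect hC ht (hmom t ht)) h₀ c1 ht
  exact (State.constraints_iff C m Λ _).mpr ⟨hham, hmom t ht, hmag t ht, hel t ht⟩

end IsSolutionOn

end EMS

end

theorem proposition1 {𝔤 : Type*} [LieRing 𝔤] [LieAlgebra ℝ 𝔤]
    (b : Module.Basis (Fin 3) ℝ 𝔤) (m Λ : ℝ)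
    (I : Set ℝ) (hI : I.OrdConnected) (h0 : (0 : ℝ) ∈ I) (s : ℝ → EMS.State)
    (hs : EMS.IsSolutionOn (EMS.structureConst b) m Λ s I) :
    (∀ t ∈ I, (s t).Constraints (EMS.structureConst b) m Λ) ↔
      (s 0).Constraints (EMS.structureConst b) m Λ :=
  ⟨fun h => h 0 h0, fun h _ ht =>
    hs.constraints (EMS.isLieTensor_structureConst b) hI h0 h ht⟩
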